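/- Let $m_1\ge 1$ and $m_2\ge 0$ be integers, and let $P_1,\dots,P_{m_1},Q_1,\dots,Q_{m_2}\in\mathbb{Z}[y]$ be polynomials with zero constant term that are (jointly) linearly independent over $\mathbb{Q}$. Then there exist constants $c,\gamma,C>0$, depending only on $P_1,\dots,P_{m_1},Q_1,\dots,Q_{m_2}$, such that for every finite field $\mathbb{F}_q$ with $q$ elements whose characteristic is at least $c$, for all functions $f_0,\dots,f_{m_1}:\mathbb{F}_q\to\mathbb{C}$ with $|f_i(x)|\le 1$ for all $i$ and all $x\in\mathbb{F}_q$, and for all additive characters $\psi_1,\dots,\psi_{m_2}$ of $\mathbb{F}_q$, one has \[ \left|\frac1{q^2}\sum_{x,y\in\mathbb{F}_q} f_0(x)\prod_{i=1}^{m_1}f_i(x+P_i(y))\prod_{j=1}^{m_2}\psi_j(Q_j(y))\;-\;1_{\Psi=1}\prod_{i=0}^{m_1}\Big(\frac1q\sum_{x\in\mathbb{F}_q}f_i(x)\Big)\right|\le C\,q^{-\gamma}, \] where $1_{\Psi=1}$ equals $1$ if every $\psi_j$ is the trivial character and $0$ otherwise. -/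

import Mathlib

open Polynomial
open scoped BigOperators

/-- A complex-valued function is `1`-bounded if its sup norm is at most `1`. -/
def IsOneBounded {α : Type*} (f : α → ℂ) : Prop :=
  ∀ x, ‖f x‖ ≤ 1

/-- The counting average
`𝔼_{x,y} f₀(x) ∏ᵢ fᵢ(x + Pᵢ(y)) ∏ⱼ gⱼ(Qⱼ(y))` over a finite field `F`. The family of polynomials
`P₁, …, P_{m₁}` is indexed by `Fin m₁`, so `P i` goes with `f i.succ`. -/
noncomputable def countingAverage {F : Type*} [Field F] [Fintype F] {m₁ m₂ : ℕ}
    (P : Fin m₁ → ℤ[X]) (Q : Fin m₂ → ℤ[X])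
    (f : Fin (m₁ + 1) → F → ℂ) (g : Fin m₂ → F → ℂ) : ℂ :=
  𝔼 x : F, 𝔼 y : F,
    f 0 x * (∏ i, f i.succ (x + aeval y (P i))) * ∏ j, g j (aeval y (Q j))

open Classical in
/-- The quantity `1_{Ψ=1}`: it is `1` if every component of `Ψ` is the trivial additive character
and `0` otherwise. -/
noncomputable def trivialIndicator {F : Type*} [Field F] {m₂ : ℕ}
    (ψ : Fin m₂ → AddChar F ℂ) : ℂ :=
  if ∀ j, ψ j = 1 then 1 else 0

/-! The proof is an induction on the number of functions besides `f₀`, for all numbers of characters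
at once. With no such function, the average is the mean of `f₀` times an exponential sum. All
characters are dilates of a single one, so independence merges the phases into one nonconstant
polynomial and Weyl differencing applies (`norm_expect_prod_addChar_pow_le`).

In the inductive step, split `f₀` into its mean and a part of mean zero. For the mean, translating
`x` by `P₀(y)` leaves one function fewer and the polynomials `Pᵢ - P₀`. For the rest, PET induction
(`exists_polyAverage_pow_le`) bounds the average by some Gowers norm of the function attached to
`P₀`, and Cauchy–Schwarz lets that function be the dual function `G`, an average over `y` of
products of the others (`norm_polyCount_sq_le`).

Degree lowering (`gowersPow_succ_pow_le`) then descends from `U^{k+2}` to `U^{k+1}`. The `k`-fold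
derivatives of `G` correlate with characters `χ_h`. Interchanging differencing with the average over
`y` tests differentiated products against alternating combinations of the `χ_h` over boxes. Where
such a combination is nontrivial, the result is a counting average in which `P₀` carries a
nontrivial character, with one function fewer, hence small by induction. Where it is trivial, `χ_h`
splits into characters each missing one coordinate of `h`, and Cauchy–Schwarz removes these. The
descent ends at the mean of `G`, which is small by induction because `f₀` has mean zero. Every loss
is polynomial, so a power saving survives. -/

open Finset ComplexConjugate

universe u

/-! ### Averages over finite types -/

section Expect

variable {ι κ : Type*} [Fintype ι] [Fintype κ]

lemma conj_expect (f : ι → ℂ) : conj (𝔼 i, f i) = 𝔼 i, conj (f i) := by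
  simp [Fintype.expect_eq_sum_div_card]

lemma ofReal_expect (f : ι → ℝ) : ((𝔼 i, f i : ℝ) : ℂ) = 𝔼 i, (f i : ℂ) := by
  simp [Fintype.expect_eq_sum_div_card]

lemma norm_expect_le_expect_norm (f : ι → ℂ) : ‖𝔼 i, f i‖ ≤ 𝔼 i, ‖f i‖ := by
  simp only [Fintype.expect_eq_sum_div_card, norm_div, Complex.norm_natCast]
  gcongr
  exact norm_sum_le _ _

lemma norm_expect_le_of_forall_le [Nonempty ι] {f : ι → ℂ} {C : ℝ} (h : ∀ i, ‖f i‖ ≤ C) :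
    ‖𝔼 i, f i‖ ≤ C :=
  (norm_expect_le_expect_norm f).trans (Finset.expect_le univ_nonempty fun i _ ↦ h i)

lemma expect_prod_type {M : Type*} [AddCommMonoid M] [Module ℚ≥0 M] (f : ι × κ → M) :
    𝔼 p, f p = 𝔼 i, 𝔼 j, f (i, j) := by
  rw [← Finset.univ_product_univ, Finset.expect_product]

lemma expect_swap {M : Type*} [AddCommMonoid M] [Module ℚ≥0 M] (f : ι → κ → M) :
    𝔼 i, 𝔼 j, f i j = 𝔼 j, 𝔼 i, f i j := Finset.expect_comm _ _ _

lemma expect_add_right {G M : Type*} [AddCommGroup G] [Fintype G] [AddCommMonoid M]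
    [Module ℚ≥0 M] (a : G) (f : G → M) : 𝔼 x, f (x + a) = 𝔼 x, f x :=
  Fintype.expect_equiv (Equiv.addRight a) _ _ fun _ ↦ rfl

lemma expect_sub_right {G M : Type*} [AddCommGroup G] [Fintype G] [AddCommMonoid M]
    [Module ℚ≥0 M] (a : G) (f : G → M) : 𝔼 x, f (x - a) = 𝔼 x, f x :=
  Fintype.expect_equiv (Equiv.subRight a) _ _ fun _ ↦ rfl

lemma expect_fin_succ {G M : Type*} [Fintype G] [AddCommMonoid M] [Module ℚ≥0 M] {k : ℕ}
    (f : (Fin (k + 1) → G) → M) : 𝔼 h, f h = 𝔼 a, 𝔼 h : Fin k → G, f (Fin.cons a h) := by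
  rw [← expect_prod_type (fun p : G × (Fin k → G) ↦ f (Fin.cons p.1 p.2))]
  exact (Fintype.expect_equiv (Fin.consEquiv fun _ ↦ G) _ _ fun _ ↦ rfl).symm

lemma expect_sq_le [Nonempty ι] (f : ι → ℝ) : (𝔼 i, f i) ^ 2 ≤ 𝔼 i, f i ^ 2 := by
  simpa using Finset.expect_mul_sq_le_sq_mul_sq univ f (fun _ ↦ (1 : ℝ))

lemma expect_pow_le [Nonempty ι] {f : ι → ℝ} (hf : ∀ i, 0 ≤ f i) (n : ℕ) :
    (𝔼 i, f i) ^ n ≤ 𝔼 i, f i ^ n := by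
  have hc : (Fintype.card ι : ℝ) ≠ 0 := by positivity
  have := Real.pow_arith_mean_le_arith_mean_pow univ (fun _ : ι ↦ 1 / (Fintype.card ι : ℝ)) f
    (fun _ _ ↦ by positivity) (by simp [hc]) (fun i _ ↦ hf i) n
  simpa [Fintype.expect_eq_sum_div_card, ← Finset.mul_sum, div_eq_inv_mul] using this

lemma norm_expect_mul_sq_le [Nonempty ι] {b a : ι → ℂ} (hb : ∀ i, ‖b i‖ ≤ 1) :
    ‖𝔼 i, b i * a i‖ ^ 2 ≤ 𝔼 i, ‖a i‖ ^ 2 := by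
  calc ‖𝔼 i, b i * a i‖ ^ 2 ≤ (𝔼 i, ‖a i‖) ^ 2 := by
        gcongr
        refine (norm_expect_le_expect_norm _).trans (Finset.expect_le_expect fun i _ ↦ ?_)
        rw [norm_mul]
        exact mul_le_of_le_one_left (norm_nonneg _) (hb i)
    _ ≤ _ := expect_sq_le _

lemma norm_expect_sq (f : ι → ℂ) :
    ((‖𝔼 i, f i‖ ^ 2 : ℝ) : ℂ) = 𝔼 i, 𝔼 j, f i * conj (f j) := by
  push_cast
  rw [← Complex.mul_conj', conj_expect, Finset.expect_mul_expect]

/-- Substituting `i = x + t` in the double average gives the form of differencing used for Gowers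
norms and Weyl sums. -/
lemma norm_expect_sq_shift {G : Type*} [AddCommGroup G] [Fintype G] (f : G → ℂ) :
    ((‖𝔼 i, f i‖ ^ 2 : ℝ) : ℂ) = 𝔼 t, 𝔼 x, f (x + t) * conj (f x) := by
  rw [norm_expect_sq, expect_swap, expect_swap (fun t x ↦ f (x + t) * conj (f x))]
  refine Finset.expect_congr rfl fun x _ ↦ ?_
  exact Fintype.expect_equiv (Equiv.subRight x) _ _ fun y ↦ by simp

end Expect

/-! ### Multiplicative derivatives and Gowers norms -/

section Gowers

variable {G : Type u} [AddCommGroup G]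

/-- The multiplicative derivative `x ↦ f (x + a) * conj (f x)`. -/
noncomputable def mulDiff (a : G) (f : G → ℂ) : G → ℂ := fun x ↦ f (x + a) * conj (f x)

/-- Iterated multiplicative derivatives. -/
noncomputable def mulDiffs : (k : ℕ) → (Fin k → G) → (G → ℂ) → G → ℂ
  | 0, _, f => f
  | k + 1, h, f => mulDiffs k (Fin.tail h) (mulDiff (h 0) f)

lemma IsOneBounded.mul {α : Type*} {f g : α → ℂ} (hf : IsOneBounded f) (hg : IsOneBounded g) :
    IsOneBounded (fun x ↦ f x * g x) := fun x ↦ by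
  rw [norm_mul]; exact mul_le_one₀ (hf x) (norm_nonneg _) (hg x)

lemma IsOneBounded.conj {α : Type*} {f : α → ℂ} (hf : IsOneBounded f) :
    IsOneBounded (fun x ↦ conj (f x)) := fun x ↦ by simpa using hf x

lemma IsOneBounded.comp {α β : Type*} {f : α → ℂ} (hf : IsOneBounded f) (g : β → α) :
    IsOneBounded (fun x ↦ f (g x)) := fun _ ↦ hf _

lemma IsOneBounded.prod {α ι : Type*} [Fintype ι] {f : ι → α → ℂ} (hf : ∀ i, IsOneBounded (f i)) :
    IsOneBounded (fun x ↦ ∏ i, f i x) := fun x ↦ by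
  rw [norm_prod]; exact Finset.prod_le_one (fun _ _ ↦ norm_nonneg _) fun i _ ↦ hf i x

lemma IsOneBounded.expect {α ι : Type*} [Fintype ι] [Nonempty ι] {f : ι → α → ℂ}
    (hf : ∀ i, IsOneBounded (f i)) : IsOneBounded (fun x ↦ 𝔼 i, f i x) :=
  fun x ↦ norm_expect_le_of_forall_le fun i ↦ hf i x

lemma IsOneBounded.mulDiff {f : G → ℂ} (hf : IsOneBounded f) (a : G) :
    IsOneBounded (mulDiff a f) := (hf.comp (· + a)).mul hf.conj

lemma IsOneBounded.mulDiffs {f : G → ℂ} (hf : IsOneBounded f) {k : ℕ} (h : Fin k → G) :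
    IsOneBounded (mulDiffs k h f) := by
  induction k generalizing f with
  | zero => exact hf
  | succ k ih => exact ih (hf.mulDiff _) _

lemma mulDiffs_mul {k : ℕ} (h : Fin k → G) (f g : G → ℂ) :
    mulDiffs k h (fun x ↦ f x * g x) = fun x ↦ mulDiffs k h f x * mulDiffs k h g x := by
  induction k generalizing f g with
  | zero => rfl
  | succ k ih =>
    simp only [mulDiffs]
    rw [← ih]
    congr 1
    ext x
    simp only [mulDiff, map_mul]
    ring

lemma mulDiffs_conj {k : ℕ} (h : Fin k → G) (f : G → ℂ) :
    mulDiffs k h (fun x ↦ conj (f x)) = fun x ↦ conj (mulDiffs k h f x) := by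
  induction k generalizing f with
  | zero => rfl
  | succ k ih =>
    simp only [mulDiffs]
    rw [← ih]
    congr 1
    ext x
    simp [mulDiff]

lemma mulDiffs_comp_add {k : ℕ} (h : Fin k → G) (f : G → ℂ) (a : G) :
    mulDiffs k h (fun x ↦ f (x + a)) = fun x ↦ mulDiffs k h f (x + a) := by
  induction k generalizing f with
  | zero => rfl
  | succ k ih =>
    simp only [mulDiffs]
    rw [← ih]
    congr 1
    ext x
    simp only [mulDiff]
    congr 2
    abel

lemma mulDiffs_prod {k : ℕ} {ι : Type*} (s : Finset ι) (h : Fin k → G) (f : ι → G → ℂ) :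
    mulDiffs k h (fun x ↦ ∏ i ∈ s, f i x) = fun x ↦ ∏ i ∈ s, mulDiffs k h (f i) x := by
  classical
  induction s using Finset.induction_on with
  | empty =>
    simp only [Finset.prod_empty]
    induction k with
    | zero => rfl
    | succ k ih =>
      have : mulDiff (h 0) (fun _ ↦ (1 : ℂ)) = fun _ ↦ 1 := by ext; simp [mulDiff]
      rw [mulDiffs, this, ih]
  | insert i s hi ih =>
    simp only [Finset.prod_insert hi]
    rw [mulDiffs_mul, ih]

variable [Fintype G]

/-- The Gowers norm `‖f‖_{U^{k+1}}` raised to the power `2 ^ (k + 1)`. -/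
noncomputable def gowersPow (k : ℕ) (f : G → ℂ) : ℝ :=
  𝔼 h : Fin k → G, ‖𝔼 x, mulDiffs k h f x‖ ^ 2

lemma gowersPow_zero (f : G → ℂ) : gowersPow 0 f = ‖𝔼 x, f x‖ ^ 2 := by
  simp [gowersPow, mulDiffs]

lemma gowersPow_succ (k : ℕ) (f : G → ℂ) :
    gowersPow (k + 1) f = 𝔼 a, gowersPow k (mulDiff a f) := by
  simp [gowersPow, expect_fin_succ, mulDiffs]

lemma gowersPow_nonneg (k : ℕ) (f : G → ℂ) : 0 ≤ gowersPow k f :=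
  Finset.expect_nonneg fun _ _ ↦ by positivity

/-- This form allows the `U²` inverse theorem to be applied to each `k`-fold derivative. -/
lemma gowersPow_succ' (k : ℕ) (f : G → ℂ) :
    gowersPow (k + 1) f = 𝔼 h : Fin k → G, gowersPow 1 (mulDiffs k h f) := by
  induction k generalizing f with
  | zero => simp [mulDiffs]
  | succ k ih =>
    rw [gowersPow_succ, expect_fin_succ]
    simp only [ih, mulDiffs, Fin.cons_zero, Fin.tail_cons]

lemma gowersPow_eq (k : ℕ) (f : G → ℂ) :
    (gowersPow k f : ℂ) = 𝔼 t, 𝔼 h : Fin k → G, 𝔼 x, mulDiffs k h (mulDiff t f) x := by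
  rw [gowersPow, ofReal_expect, expect_swap]
  refine Finset.expect_congr rfl fun h _ ↦ ?_
  rw [norm_expect_sq_shift]
  refine Finset.expect_congr rfl fun t _ ↦ Finset.expect_congr rfl fun x _ ↦ ?_
  unfold mulDiff
  rw [mulDiffs_mul, mulDiffs_comp_add, mulDiffs_conj]

/-- Monotonicity of Gowers norms: Cauchy–Schwarz in the shift at the lowest level, then applied to
derivatives. -/
lemma gowersPow_sq_le (k : ℕ) (f : G → ℂ) : gowersPow k f ^ 2 ≤ gowersPow (k + 1) f := by
  induction k generalizing f with
  | zero =>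
    rw [gowersPow_succ, gowersPow_zero]
    simp only [gowersPow_zero]
    have h : ((‖𝔼 x, f x‖ ^ 2 : ℝ) : ℂ) = 𝔼 t, 𝔼 x, mulDiff t f x := norm_expect_sq_shift f
    have h2 : ‖𝔼 x, f x‖ ^ 2 = ‖𝔼 t, 𝔼 x, mulDiff t f x‖ := by
      rw [← h, Complex.norm_real, Real.norm_of_nonneg (by positivity)]
    rw [h2]
    exact (pow_le_pow_left₀ (norm_nonneg _) (norm_expect_le_expect_norm _) 2).trans
      (expect_sq_le _)
  | succ k ih =>
    rw [gowersPow_succ, gowersPow_succ (k + 1)]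
    exact (expect_sq_le _).trans (Finset.expect_le_expect fun a _ ↦ ih _)

lemma gowersPow_comp_add (k : ℕ) (f : G → ℂ) (a : G) :
    gowersPow k (fun x ↦ f (x + a)) = gowersPow k f := by
  simp only [gowersPow, mulDiffs_comp_add]
  simp only [expect_add_right a]

end Gowers

/-! ### Parseval and the `U²` inverse theorem -/

section Fourier

variable {G : Type u} [AddCommGroup G] [Fintype G]

lemma sum_norm_expect_mul_addChar_sq (f : G → ℂ) :
    ∑ χ : AddChar G ℂ, ‖𝔼 x, f x * χ x‖ ^ 2 = 𝔼 x, ‖f x‖ ^ 2 := by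
  classical
  have hc : (Fintype.card G : ℂ) ≠ 0 := by simp
  apply Complex.ofReal_injective
  rw [Complex.ofReal_sum, ofReal_expect]
  simp only [norm_expect_sq]
  rw [← Finset.expect_sum_comm]
  refine Finset.expect_congr rfl fun x _ ↦ ?_
  rw [← Finset.expect_sum_comm]
  have : ∀ y, ∑ χ : AddChar G ℂ, f x * χ x * conj (f y * χ y) =
      if y = x then f x * conj (f x) * Fintype.card G else 0 := by
    intro y
    have h1 : ∀ χ : AddChar G ℂ, f x * χ x * conj (f y * χ y) =
        f x * conj (f y) * χ (x - y) := by
      intro χ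
      rw [sub_eq_add_neg, AddChar.map_add_eq_mul, AddChar.map_neg_eq_conj, map_mul]
      ring
    simp only [h1, ← Finset.mul_sum, AddChar.sum_apply_eq_ite, sub_eq_zero, eq_comm (a := x)]
    split_ifs with h
    · rw [h]
    · simp
  simp only [this, Fintype.expect_eq_sum_div_card, Finset.sum_ite_eq', Finset.mem_univ, if_true]
  rw [mul_div_cancel_right₀ _ hc, Complex.mul_conj']
  push_cast
  rfl

/-- The inverse theorem for the `U²` norm. -/
lemma exists_gowersPow_one_le {f : G → ℂ} (hf : IsOneBounded f) :
    ∃ χ : AddChar G ℂ, gowersPow 1 f ≤ ‖𝔼 x, f x * χ x‖ ^ 2 := by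
  obtain ⟨χ₀, hχ₀⟩ := Finite.exists_max fun χ : AddChar G ℂ ↦ ‖𝔼 x, f x * χ x‖ ^ 2
  refine ⟨χ₀, ?_⟩
  have h1 : gowersPow 1 f = 𝔼 a, ‖𝔼 x, mulDiff a f x‖ ^ 2 := by
    rw [gowersPow_succ]; simp only [gowersPow_zero]
  rw [h1, ← sum_norm_expect_mul_addChar_sq]
  -- The mean of the derivative, as a function of `a`, is the autocorrelation of `f`, so its Fourier
  -- coefficients are squared moduli. Parseval thus gives a sum of fourth powers, from which the
  -- largest square is pulled out.
  have h2 : ∀ χ : AddChar G ℂ, ‖𝔼 a, (𝔼 x, mulDiff a f x) * χ a‖ = ‖𝔼 x, f x * χ x‖ ^ 2 := by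
    intro χ
    have : 𝔼 a, (𝔼 x, mulDiff a f x) * χ a = ((‖𝔼 x, f x * χ x‖ ^ 2 : ℝ) : ℂ) := by
      rw [norm_expect_sq_shift]
      refine Finset.expect_congr rfl fun a _ ↦ ?_
      rw [Finset.expect_mul]
      refine Finset.expect_congr rfl fun x _ ↦ ?_
      have hx : χ x * conj (χ x) = 1 := by
        rw [Complex.mul_conj', AddChar.norm_apply]; simp
      rw [mulDiff, AddChar.map_add_eq_mul, map_mul]
      linear_combination (-(f (x + a) * conj (f x) * χ a)) * hx
    rw [this, Complex.norm_real, Real.norm_of_nonneg (by positivity)]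
  simp only [h2]
  calc ∑ χ : AddChar G ℂ, (‖𝔼 x, f x * χ x‖ ^ 2) ^ 2
      ≤ ∑ χ : AddChar G ℂ, ‖𝔼 x, f x * χ₀ x‖ ^ 2 * ‖𝔼 x, f x * χ x‖ ^ 2 := by
        refine Finset.sum_le_sum fun χ _ ↦ ?_
        rw [sq (‖𝔼 x, f x * χ x‖ ^ 2)]
        exact mul_le_mul_of_nonneg_right (hχ₀ χ) (by positivity)
    _ = ‖𝔼 x, f x * χ₀ x‖ ^ 2 * 𝔼 x, ‖f x‖ ^ 2 := by
        rw [← Finset.mul_sum, sum_norm_expect_mul_addChar_sq]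
    _ ≤ ‖𝔼 x, f x * χ₀ x‖ ^ 2 := by
        refine mul_le_of_le_one_right (by positivity) (Finset.expect_le univ_nonempty fun x _ ↦ ?_)
        exact pow_le_one₀ (norm_nonneg _) (hf x)

end Fourier

/-! ### Box averages and Gowers–Cauchy–Schwarz -/

section Box

variable {G : Type u}

/-- The alternating product of `A` over the vertices of the box with opposite corners `h`, `h'`. -/
noncomputable def cubeProd : (k : ℕ) → ((Fin k → G) → ℂ) → (Fin k → G) → (Fin k → G) → ℂ
  | 0, A, h, _ => A h
  | k + 1, A, h, h' => cubeProd k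
      (fun u ↦ A (Fin.cons (h 0) u) * conj (A (Fin.cons (h' 0) u))) (Fin.tail h) (Fin.tail h')

/-- The alternating product of a group-valued function over the vertices of a box. -/
def cubeQuot {Γ : Type*} [CommGroup Γ] :
    (k : ℕ) → ((Fin k → G) → Γ) → (Fin k → G) → (Fin k → G) → Γ
  | 0, A, h, _ => A h
  | k + 1, A, h, h' => cubeQuot k
      (fun u ↦ A (Fin.cons (h 0) u) / A (Fin.cons (h' 0) u)) (Fin.tail h) (Fin.tail h')

/-- `B` is a product of `k` functions bounded by `1`, the `i`-th of which does not depend on the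
`i`-th coordinate. -/
def IsLowerOrder : (k : ℕ) → ((Fin k → G) → ℂ) → Prop
  | 0, B => ∀ h, B h = 1
  | k + 1, B => ∃ (B₀ : (Fin k → G) → ℂ) (B₁ : G → (Fin k → G) → ℂ), IsOneBounded B₀ ∧
      (∀ a, IsLowerOrder k (B₁ a)) ∧ ∀ a u, B (Fin.cons a u) = B₀ u * B₁ a u

lemma IsLowerOrder.mul {k : ℕ} {B C : (Fin k → G) → ℂ} (hB : IsLowerOrder k B)
    (hC : IsLowerOrder k C) : IsLowerOrder k (fun h ↦ B h * C h) := by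
  induction k with
  | zero => exact fun h ↦ by simp [hB h, hC h]
  | succ k ih =>
    obtain ⟨B₀, B₁, hB₀, hB₁, hB⟩ := hB
    obtain ⟨C₀, C₁, hC₀, hC₁, hC⟩ := hC
    refine ⟨_, _, hB₀.mul hC₀, fun a ↦ ih (hB₁ a) (hC₁ a), fun a u ↦ ?_⟩
    simp only [hB, hC]
    ring

lemma IsLowerOrder.conj {k : ℕ} {B : (Fin k → G) → ℂ} (hB : IsLowerOrder k B) :
    IsLowerOrder k (fun h ↦ conj (B h)) := by
  induction k with
  | zero => exact fun h ↦ by simp [hB h]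
  | succ k ih =>
    obtain ⟨B₀, B₁, hB₀, hB₁, hB⟩ := hB
    exact ⟨_, _, hB₀.conj, fun a ↦ ih (hB₁ a), fun a u ↦ by simp [hB]⟩

lemma cubeProd_mul {k : ℕ} (A B : (Fin k → G) → ℂ) (h h' : Fin k → G) :
    cubeProd k (fun u ↦ A u * B u) h h' = cubeProd k A h h' * cubeProd k B h h' := by
  induction k with
  | zero => rfl
  | succ k ih =>
    simp only [cubeProd]
    rw [← ih]
    congr 1
    ext u
    simp only [map_mul]
    ring

lemma norm_cubeProd_le {k : ℕ} {A : (Fin k → G) → ℂ} (hA : IsOneBounded A) (h h' : Fin k → G) :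
    ‖cubeProd k A h h'‖ ≤ ‖A h‖ := by
  induction k with
  | zero => rfl
  | succ k ih =>
    simp only [cubeProd]
    refine (ih ((hA.comp _).mul (hA.comp _).conj) _ _).trans ?_
    rw [norm_mul, Fin.cons_self_tail]
    exact mul_le_of_le_one_right (norm_nonneg _) (by simpa using hA _)

/-- The Gowers–Cauchy–Schwarz inequality for box averages. -/
lemma norm_expect_pow_le_cubeProd [Fintype G] [Nonempty G] {k : ℕ} :
    ∀ {X : Type u} [Fintype X] [Nonempty X] (A B : X → (Fin k → G) → ℂ),
      (∀ x, IsLowerOrder k (B x)) →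
      ‖𝔼 x, 𝔼 h, B x h * A x h‖ ^ 2 ^ k ≤ ‖𝔼 x, 𝔼 h, 𝔼 h', cubeProd k (A x) h h'‖ := by
  induction k with
  | zero =>
    intro X _ _ A B hB
    have : ∀ x h, B x h = 1 := fun x h ↦ hB x h
    simp [this, cubeProd]
  | succ k ih =>
    intro X _ _ A B hB
    choose B₀ B₁ hB₀ hB₁ hB using hB
    -- Cauchy–Schwarz in `(x, u)` discards `B₀`, which is free of the first coordinate, and doubles
    -- that coordinate.
    have key : ‖𝔼 x, 𝔼 h, B x h * A x h‖ ^ 2 ≤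
        ‖𝔼 p : X × G × G, 𝔼 u : Fin k → G, (B₁ p.1 p.2.1 u * conj (B₁ p.1 p.2.2 u)) *
          (A p.1 (Fin.cons p.2.1 u) * conj (A p.1 (Fin.cons p.2.2 u)))‖ := by
      have h1 : 𝔼 x, 𝔼 h, B x h * A x h = 𝔼 q : X × (Fin k → G), B₀ q.1 q.2 *
          𝔼 a, B₁ q.1 a q.2 * A q.1 (Fin.cons a q.2) := by
        rw [expect_prod_type]
        refine Finset.expect_congr rfl fun x _ ↦ ?_
        rw [expect_fin_succ, expect_swap]
        refine Finset.expect_congr rfl fun u _ ↦ ?_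
        rw [Finset.mul_expect]
        refine Finset.expect_congr rfl fun a _ ↦ ?_
        simp only [hB]
        ring
      rw [h1]
      refine (norm_expect_mul_sq_le (b := fun q : X × (Fin k → G) ↦ B₀ q.1 q.2)
        fun q ↦ hB₀ q.1 q.2).trans ?_
      have h2 : ((𝔼 q : X × (Fin k → G), ‖𝔼 a, B₁ q.1 a q.2 * A q.1 (Fin.cons a q.2)‖ ^ 2 : ℝ) : ℂ)
          = 𝔼 p : X × G × G, 𝔼 u : Fin k → G, (B₁ p.1 p.2.1 u * conj (B₁ p.1 p.2.2 u)) *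
          (A p.1 (Fin.cons p.2.1 u) * conj (A p.1 (Fin.cons p.2.2 u))) := by
        rw [ofReal_expect, expect_prod_type, expect_prod_type]
        refine Finset.expect_congr rfl fun x _ ↦ ?_
        rw [expect_prod_type]
        simp only [norm_expect_sq]
        rw [expect_swap]
        refine Finset.expect_congr rfl fun a _ ↦ ?_
        rw [expect_swap]
        refine Finset.expect_congr rfl fun a' _ ↦ Finset.expect_congr rfl fun u _ ↦ ?_
        simp only [map_mul]
        ring
      rw [← h2, Complex.norm_real]
      exact le_abs_self _
    rw [pow_succ', pow_mul]
    refine (pow_le_pow_left₀ (by positivity) key _).trans ?_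
    -- The doubled coordinate becomes part of the parameter; this is why `X` varies in the
    -- induction.
    refine (ih (X := X × G × G)
      (fun p u ↦ A p.1 (Fin.cons p.2.1 u) * conj (A p.1 (Fin.cons p.2.2 u)))
      (fun p u ↦ B₁ p.1 p.2.1 u * conj (B₁ p.1 p.2.2 u))
      fun p ↦ (hB₁ _ _).mul (hB₁ _ _).conj).trans (le_of_eq ?_)
    congr 1
    rw [expect_prod_type]
    refine Finset.expect_congr rfl fun x _ ↦ ?_
    rw [expect_prod_type, expect_fin_succ]
    refine Finset.expect_congr rfl fun a _ ↦ ?_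
    simp only [expect_fin_succ, cubeProd, Fin.cons_zero, Fin.tail_cons]
    rw [expect_swap]

variable [AddCommGroup G]

/-- A function of the coordinate sum sees the box as a parallelepiped with edges `h - h'`. -/
lemma cubeProd_comp_sum {k : ℕ} (g : G → ℂ) (x : G) (h h' : Fin k → G) :
    cubeProd k (fun u ↦ g (x + ∑ i, u i)) h h' = mulDiffs k (h - h') g (x + ∑ i, h' i) := by
  induction k generalizing g x with
  | zero => simp [cubeProd, mulDiffs]
  | succ k ih =>
    have h1 : (fun u : Fin k → G ↦ g (x + ∑ i, (Fin.cons (h 0) u : Fin (k + 1) → G) i) *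
        conj (g (x + ∑ i, (Fin.cons (h' 0) u : Fin (k + 1) → G) i))) =
        fun u ↦ mulDiff (h 0 - h' 0) g ((x + h' 0) + ∑ i, u i) := by
      ext u
      simp only [mulDiff, Fin.sum_univ_succ, Fin.cons_zero, Fin.cons_succ]
      congr 2
      · abel
      · congr 1; abel
    simp only [cubeProd, mulDiffs]
    rw [h1, ih, Fin.sum_univ_succ, add_assoc]
    rfl

lemma cubeProd_addChar [Finite G] {k : ℕ} (χ : (Fin k → G) → AddChar G ℂ) (x : G)
    (h h' : Fin k → G) : cubeProd k (fun u ↦ χ u x) h h' = cubeQuot k χ h h' x := by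
  induction k with
  | zero => rfl
  | succ k ih =>
    simp only [cubeProd, cubeQuot]
    rw [← ih]
    congr 1
    ext u
    rw [AddChar.div_apply, ← AddChar.map_neg_eq_conj, AddChar.map_neg_eq_inv]

/-- The vertex `h` cancels in the quotient, and every other vertex uses some `h' i` in place of `h
i`. -/
lemma isLowerOrder_div_cubeQuot [Finite G] {k : ℕ} (χ : (Fin k → G) → AddChar G ℂ)
    (h' : Fin k → G) (t : G) : IsLowerOrder k (fun h ↦ (χ h / cubeQuot k χ h h') t) := by
  induction k with
  | zero => exact fun h ↦ by simp [cubeQuot]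
  | succ k ih =>
    refine ⟨fun u ↦ χ (Fin.cons (h' 0) u) t, _, fun u ↦ by simp, fun a ↦
      ih (fun u ↦ χ (Fin.cons a u) / χ (Fin.cons (h' 0) u)) (Fin.tail h'), fun a u ↦ ?_⟩
    simp only [cubeQuot, Fin.cons_zero, Fin.tail_cons]
    rw [← AddChar.mul_apply]
    congr 1
    rw [← mul_div_assoc, mul_div_cancel]

/-- Only the top vertex `x + ∑ i, h i` of the cube involves all shifts; the other vertices go into
`B`. -/
lemma exists_mulDiffs_eq {k : ℕ} {g : G → ℂ} (hg : IsOneBounded g) (x : G) :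
    ∃ B : (Fin k → G) → ℂ, IsLowerOrder k B ∧
      ∀ h, mulDiffs k h g x = B h * g (x + ∑ i, h i) := by
  induction k generalizing x with
  | zero => exact ⟨fun _ ↦ 1, fun _ ↦ rfl, fun h ↦ by simp [mulDiffs]⟩
  | succ k ih =>
    choose B hB hgB using ih
    refine ⟨fun h ↦ conj (mulDiffs k (Fin.tail h) g x) * B (x + h 0) (Fin.tail h),
      ⟨fun u ↦ conj (mulDiffs k u g x), fun a ↦ B (x + a), ?_, fun a ↦ hB _, fun a u ↦ by simp⟩,
      fun h ↦ ?_⟩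
    · intro u
      simpa using hg.mulDiffs u x
    · have : mulDiffs (k + 1) h g x =
          mulDiffs k (Fin.tail h) g (x + h 0) * conj (mulDiffs k (Fin.tail h) g x) := by
        rw [mulDiffs]
        unfold mulDiff
        rw [mulDiffs_mul, mulDiffs_comp_add, mulDiffs_conj]
      rw [this, hgB, Fin.sum_univ_succ, add_assoc]
      simp only [Fin.tail]
      ring

end Box

/-! ### Degree lowering -/

section DegreeLowering

variable {G : Type u} [AddCommGroup G] [Fintype G] {k : ℕ}

lemma expect_mulDiffs_sub (k : ℕ) (f : G → ℂ) :
    𝔼 x, 𝔼 h : Fin k → G, 𝔼 h', mulDiffs k (h - h') f (x + ∑ i, h' i) =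
      𝔼 h : Fin k → G, 𝔼 x, mulDiffs k h f x := by
  have h1 : ∀ h' : Fin k → G, 𝔼 x, 𝔼 h : Fin k → G, mulDiffs k (h - h') f (x + ∑ i, h' i) =
      𝔼 h : Fin k → G, 𝔼 x, mulDiffs k h f x := by
    intro h'
    rw [expect_swap, ← expect_sub_right h' (fun h ↦ 𝔼 x, mulDiffs k h f x)]
    exact Finset.expect_congr rfl fun h _ ↦ expect_add_right _ _
  have h2 : ∀ x, 𝔼 h : Fin k → G, 𝔼 h', mulDiffs k (h - h') f (x + ∑ i, h' i) =
      𝔼 h', 𝔼 h : Fin k → G, mulDiffs k (h - h') f (x + ∑ i, h' i) := fun x ↦ expect_swap _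
  simp only [h2]
  rw [expect_swap]
  simp only [h1, Fintype.expect_const]

/-- Expanding the square reduces the phase to `ρ h t`, which is free of `x` and of lower order in
`h`. Box Cauchy–Schwarz removes it along with the lower vertices of the cube. -/
lemma expect_norm_mulDiffs_mul_addChar_sq_pow_le {g : G → ℂ} (hg : IsOneBounded g)
    {ρ : (Fin k → G) → AddChar G ℂ} (hρ : ∀ t, IsLowerOrder k fun h ↦ ρ h t) :
    (𝔼 h, ‖𝔼 x, mulDiffs k h g x * ρ h x‖ ^ 2) ^ 2 ^ k ≤ gowersPow k g := by
  choose B hB hgB using fun p : G × G ↦ exists_mulDiffs_eq (k := k) (hg.mulDiff p.1) p.2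
  have h1 : ((𝔼 h, ‖𝔼 x, mulDiffs k h g x * ρ h x‖ ^ 2 : ℝ) : ℂ) =
      𝔼 p : G × G, 𝔼 h : Fin k → G, (ρ h p.1 * B p h) * mulDiff p.1 g (p.2 + ∑ i, h i) := by
    rw [ofReal_expect]
    simp only [norm_expect_sq_shift]
    rw [expect_prod_type, expect_swap]
    refine Finset.expect_congr rfl fun t _ ↦ ?_
    rw [expect_swap]
    refine Finset.expect_congr rfl fun x _ ↦ Finset.expect_congr rfl fun h _ ↦ ?_
    have hx : ρ h x * conj (ρ h x) = 1 := by
      rw [Complex.mul_conj', AddChar.norm_apply]; simp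
    have h2 : mulDiffs k h (mulDiff t g) x =
        mulDiffs k h g (x + t) * conj (mulDiffs k h g x) := by
      unfold mulDiff
      rw [mulDiffs_mul, mulDiffs_comp_add, mulDiffs_conj]
    rw [mul_assoc (ρ h _), ← hgB (t, x) h, h2, AddChar.map_add_eq_mul, map_mul]
    linear_combination (mulDiffs k h g (x + t) * conj (mulDiffs k h g x) * ρ h t) * hx
  have h3 := norm_expect_pow_le_cubeProd (X := G × G)
    (fun p h ↦ mulDiff p.1 g (p.2 + ∑ i, h i)) (fun p h ↦ ρ h p.1 * B p h)
    (fun p ↦ (hρ p.1).mul (hB p))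
  rw [← h1, Complex.norm_real, Real.norm_of_nonneg
    (Finset.expect_nonneg fun _ _ ↦ by positivity)] at h3
  refine h3.trans (le_of_eq ?_)
  rw [← Real.norm_of_nonneg (gowersPow_nonneg k g), ← Complex.norm_real, gowersPow_eq,
    expect_prod_type]
  congr 1
  refine Finset.expect_congr rfl fun t _ ↦ ?_
  simp only [cubeProd_comp_sum]
  exact expect_mulDiffs_sub k _

/-- Dual-difference interchange: `c h` denotes a Fourier coefficient of `mulDiffs k h g`, where `g`
is an average of the functions `f y`. -/
lemma exists_expect_pow_le {Y : Type u} [Fintype Y] [Nonempty Y] {f : Y → G → ℂ}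
    (hf : ∀ y, IsOneBounded (f y)) {ε : ℝ}
    (hε : ∀ (h : Fin k → G) (χ : AddChar G ℂ), χ ≠ 1 →
      ‖𝔼 x, 𝔼 y, mulDiffs k h (f y) x * χ x‖ ≤ ε) (hε0 : 0 ≤ ε)
    (χ : (Fin k → G) → AddChar G ℂ) (c : (Fin k → G) → ℂ)
    (hc : ∀ h, c h = 𝔼 x, mulDiffs k h (fun x ↦ 𝔼 y, f y x) x * χ h x) :
    ∃ h', (𝔼 h, ‖c h‖ ^ 2) ^ 2 ^ k ≤
      ε + 𝔼 h, ‖𝔼 x, mulDiffs k h (fun x ↦ 𝔼 y, f y x) x * (χ h / cubeQuot k χ h h') x‖ := by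
  have hg : IsOneBounded fun x ↦ 𝔼 y, f y x := IsOneBounded.expect hf
  have hc1 : IsOneBounded c := fun h ↦ by
    rw [hc]
    refine norm_expect_le_of_forall_le fun x ↦ ?_
    rw [norm_mul, AddChar.norm_apply, mul_one]
    exact hg.mulDiffs h x
  choose B hB hgB using fun x ↦ exists_mulDiffs_eq (k := k) hg x
  -- Only the top vertex is opened up as an average over `y`; the lower vertices stay in `B` and are
  -- about to be discarded.
  have h1 : ((𝔼 h, ‖c h‖ ^ 2 : ℝ) : ℂ) = 𝔼 p : G × Y, 𝔼 h : Fin k → G, B p.1 h *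
      (conj (c h) * (f p.2 (p.1 + ∑ i, h i) * χ h p.1)) := by
    rw [ofReal_expect, expect_prod_type]
    have : ∀ x, 𝔼 y, 𝔼 h : Fin k → G, B x h * (conj (c h) * (f y (x + ∑ i, h i) * χ h x)) =
        𝔼 h, conj (c h) * (mulDiffs k h (fun x ↦ 𝔼 y, f y x) x * χ h x) := by
      intro x
      rw [expect_swap]
      refine Finset.expect_congr rfl fun h _ ↦ ?_
      rw [hgB, Finset.mul_expect, Finset.expect_mul, Finset.mul_expect]
      exact Finset.expect_congr rfl fun y _ ↦ by ring
    simp only [this]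
    rw [expect_swap]
    refine Finset.expect_congr rfl fun h _ ↦ ?_
    rw [← Finset.mul_expect, ← hc, mul_comm, Complex.mul_conj']
    push_cast
    rfl
  have h2 := norm_expect_pow_le_cubeProd (X := G × Y)
    (fun p h ↦ conj (c h) * (f p.2 (p.1 + ∑ i, h i) * χ h p.1)) (fun p h ↦ B p.1 h)
    (fun p ↦ hB p.1)
  rw [← h1, Complex.norm_real, Real.norm_of_nonneg
    (Finset.expect_nonneg fun _ _ ↦ by positivity)] at h2
  set T : (Fin k → G) → (Fin k → G) → ℝ := fun h' h ↦
    ‖𝔼 x, mulDiffs k h (fun x ↦ 𝔼 y, f y x) x * (χ h / cubeQuot k χ h h') x‖ with hT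
  have h3 : ∀ h h', ‖𝔼 x, 𝔼 y, cubeProd k
      (fun h ↦ conj (c h) * (f y (x + ∑ i, h i) * χ h x)) h h'‖ ≤ ε + T h' h := by
    intro h h'
    set ρ := cubeQuot k χ h h' with hρ
    have h4 : 𝔼 x, 𝔼 y, cubeProd k (fun h ↦ conj (c h) * (f y (x + ∑ i, h i) * χ h x)) h h' =
        cubeProd k (fun h ↦ conj (c h)) h h' * conj (ρ (∑ i, h' i)) *
          𝔼 x, 𝔼 y, mulDiffs k (h - h') (f y) x * ρ x := by
      rw [← expect_add_right (∑ i, h' i) (fun x ↦ 𝔼 y, mulDiffs k (h - h') (f y) x * ρ x),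
        Finset.mul_expect]
      refine Finset.expect_congr rfl fun x _ ↦ ?_
      rw [Finset.mul_expect]
      refine Finset.expect_congr rfl fun y _ ↦ ?_
      have hx : ρ (∑ i, h' i) * conj (ρ (∑ i, h' i)) = 1 := by
        rw [Complex.mul_conj', AddChar.norm_apply]; simp
      rw [cubeProd_mul, cubeProd_mul, cubeProd_comp_sum, cubeProd_addChar, ← hρ,
        AddChar.map_add_eq_mul]
      linear_combination (-(cubeProd k (fun h ↦ conj (c h)) h h' *
        mulDiffs k (h - h') (f y) (x + ∑ i, h' i) * ρ x)) * hx
    have h5 : ‖cubeProd k (fun h ↦ conj (c h)) h h'‖ ≤ ‖c h‖ := by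
      simpa using norm_cubeProd_le hc1.conj h h'
    rw [h4, norm_mul, norm_mul, RCLike.norm_conj, AddChar.norm_apply, mul_one]
    -- If the box quotient is trivial, dividing by it changes nothing and the term is at most `‖c h‖
    -- = T h' h`. Otherwise `hε` applies.
    by_cases hρ1 : ρ = 1
    · have h6 : ‖𝔼 x, 𝔼 y, mulDiffs k (h - h') (f y) x * ρ x‖ ≤ 1 :=
        norm_expect_le_of_forall_le fun x ↦ norm_expect_le_of_forall_le fun y ↦ by
          rw [norm_mul, AddChar.norm_apply, mul_one]
          exact (hf y).mulDiffs _ x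
      have h7 : T h' h = ‖c h‖ := by
        simp only [hT]
        rw [← hρ, hρ1, div_one, hc]
      rw [h7]
      calc _ ≤ ‖c h‖ * 1 := mul_le_mul h5 h6 (norm_nonneg _) (norm_nonneg _)
        _ ≤ _ := by linarith
    · calc _ ≤ 1 * ε := mul_le_mul (h5.trans (hc1 h)) (hε _ _ hρ1) (norm_nonneg _) zero_le_one
        _ ≤ _ := by rw [one_mul]; exact le_add_of_nonneg_right (norm_nonneg _)
  obtain ⟨h', -, hh'⟩ := Finset.exists_le_of_le_expect (s := univ)
    (f := fun h' ↦ ε + 𝔼 h, T h' h) univ_nonempty (a := (𝔼 h, ‖c h‖ ^ 2) ^ 2 ^ k) <| by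
      refine h2.trans ?_
      have h8 : 𝔼 p : G × Y, 𝔼 h, 𝔼 h', cubeProd k
          (fun h ↦ conj (c h) * (f p.2 (p.1 + ∑ i, h i) * χ h p.1)) h h' =
          𝔼 h', 𝔼 h, 𝔼 x, 𝔼 y, cubeProd k
          (fun h ↦ conj (c h) * (f y (x + ∑ i, h i) * χ h x)) h h' := by
        rw [expect_swap (fun h' h ↦ 𝔼 x, 𝔼 y, cubeProd k
          (fun h ↦ conj (c h) * (f y (x + ∑ i, h i) * χ h x)) h h'), expect_swap]
        refine Finset.expect_congr rfl fun h _ ↦ ?_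
        rw [expect_swap]
        refine Finset.expect_congr rfl fun h' _ ↦ ?_
        rw [expect_prod_type]
      rw [h8]
      refine (norm_expect_le_expect_norm _).trans (Finset.expect_le_expect fun h' _ ↦ ?_)
      refine (norm_expect_le_expect_norm _).trans ?_
      calc _ ≤ 𝔼 h, (ε + T h' h) := Finset.expect_le_expect fun h _ ↦ h3 h h'
        _ = _ := by rw [Finset.expect_add_distrib, Fintype.expect_const]
  exact ⟨h', hh'⟩

/-- Up to `ε`, the large Fourier coefficients at `χ h` give correlation with `χ h / cubeQuot k χ h
h'`, which is of lower order in `h` and can be removed. The interchange costs the power `2 ^ k`;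
passing to second moments and removing the phase costs `2 ^ (k + 1)`. -/
lemma gowersPow_succ_pow_le {Y : Type u} [Fintype Y] [Nonempty Y] {f : Y → G → ℂ}
    (hf : ∀ y, IsOneBounded (f y)) {ε : ℝ}
    (hε : ∀ (h : Fin k → G) (χ : AddChar G ℂ), χ ≠ 1 →
      ‖𝔼 x, 𝔼 y, mulDiffs k h (f y) x * χ x‖ ≤ ε) (hε0 : 0 ≤ ε) (hε1 : ε ≤ 1) :
    gowersPow (k + 1) (fun x ↦ 𝔼 y, f y x) ^ (2 ^ k * 2 ^ (k + 1)) ≤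
      2 ^ 2 ^ (k + 1) * (ε + gowersPow k (fun x ↦ 𝔼 y, f y x)) := by
  set g : G → ℂ := fun x ↦ 𝔼 y, f y x with hgdef
  have hg : IsOneBounded g := IsOneBounded.expect hf
  choose χ hχ using fun h : Fin k → G ↦ exists_gowersPow_one_le (hg.mulDiffs h)
  obtain ⟨h', hh'⟩ := exists_expect_pow_le hf hε hε0 χ _ fun h ↦ rfl
  rw [← hgdef] at hh'
  set T := 𝔼 h, ‖𝔼 x, mulDiffs k h g x * (χ h / cubeQuot k χ h h') x‖ with hT
  have hT0 : 0 ≤ T := Finset.expect_nonneg fun _ _ ↦ norm_nonneg _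
  have h1 : T ^ 2 ^ (k + 1) ≤ gowersPow k g := by
    rw [pow_succ', pow_mul]
    refine (pow_le_pow_left₀ (by positivity) (expect_sq_le _) _).trans ?_
    exact expect_norm_mulDiffs_mul_addChar_sq_pow_le hg (isLowerOrder_div_cubeQuot χ h')
  have h2 : gowersPow (k + 1) g ≤ 𝔼 h, ‖𝔼 x, mulDiffs k h g x * χ h x‖ ^ 2 := by
    rw [gowersPow_succ']
    exact Finset.expect_le_expect fun h _ ↦ hχ h
  have h3 : gowersPow (k + 1) g ^ 2 ^ k ≤ ε + T :=
    (pow_le_pow_left₀ (gowersPow_nonneg _ _) h2 _).trans hh'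
  rw [pow_mul]
  calc _ ≤ (ε + T) ^ 2 ^ (k + 1) :=
        pow_le_pow_left₀ (pow_nonneg (gowersPow_nonneg _ _) _) h3 _
    _ ≤ 2 ^ (2 ^ (k + 1) - 1) * (ε ^ 2 ^ (k + 1) + T ^ 2 ^ (k + 1)) := add_pow_le hε0 hT0 _
    _ ≤ 2 ^ 2 ^ (k + 1) * (ε + gowersPow k g) := by
        have : ε ^ 2 ^ (k + 1) ≤ ε := pow_le_of_le_one hε0 hε1 (by positivity)
        gcongr
        · norm_num
        · exact Nat.sub_le _ _

end DegreeLowering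

/-- Iterated degree lowering for averages `g` of functions `f y`. -/
lemma exists_gowersPow_pow_le (k : ℕ) : ∃ (M : ℕ) (A : ℝ), 0 < M ∧ 0 < A ∧
    ∀ {G : Type u} [AddCommGroup G] [Fintype G] {Y : Type u} [Fintype Y] [Nonempty Y]
      {f : Y → G → ℂ} (_ : ∀ y, IsOneBounded (f y)) {ε : ℝ} (_ : 0 ≤ ε) (_ : ε ≤ 1)
      (_ : ∀ (k : ℕ) (h : Fin k → G) (χ : AddChar G ℂ), χ ≠ 1 →
        ‖𝔼 x, 𝔼 y, mulDiffs k h (f y) x * χ x‖ ≤ ε) (_ : ‖𝔼 x, 𝔼 y, f y x‖ ≤ ε),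
      gowersPow k (fun x ↦ 𝔼 y, f y x) ^ M ≤ A * ε := by
  induction k with
  | zero =>
    refine ⟨1, 1, one_pos, one_pos, fun hf ε hε0 hε1 _ h ↦ ?_⟩
    rw [pow_one, one_mul, gowersPow_zero]
    calc _ ≤ ε ^ 2 := by gcongr
      _ ≤ ε := pow_le_of_le_one hε0 hε1 two_ne_zero
  | succ k ih =>
    obtain ⟨M, A, hM, hA, ih⟩ := ih
    refine ⟨2 ^ k * 2 ^ (k + 1) * M, (2 ^ 2 ^ (k + 1)) ^ M * (2 ^ (M - 1) * (1 + A)), by positivity,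
      by positivity, fun {G} _ _ {Y} _ _ f hf ε hε0 hε1 h h0 ↦ ?_⟩
    have h1 := gowersPow_succ_pow_le hf (h k) hε0 hε1
    have h2 := ih hf hε0 hε1 h h0
    have h3 := gowersPow_nonneg k fun x ↦ 𝔼 y, f y x
    rw [pow_mul]
    calc _ ≤ (2 ^ 2 ^ (k + 1) * (ε + gowersPow k (fun x ↦ 𝔼 y, f y x))) ^ M :=
          pow_le_pow_left₀ (pow_nonneg (gowersPow_nonneg _ _) _) h1 _
      _ = (2 ^ 2 ^ (k + 1)) ^ M * (ε + gowersPow k (fun x ↦ 𝔼 y, f y x)) ^ M := mul_pow _ _ _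
      _ ≤ (2 ^ 2 ^ (k + 1)) ^ M * (2 ^ (M - 1) *
          (ε ^ M + gowersPow k (fun x ↦ 𝔼 y, f y x) ^ M)) := by
          gcongr
          exact add_pow_le hε0 h3 _
      _ ≤ (2 ^ 2 ^ (k + 1)) ^ M * (2 ^ (M - 1) * (ε + A * ε)) := by
          gcongr
          exact pow_le_of_le_one hε0 hε1 hM.ne'
      _ = _ := by ring

/-! ### Van der Corput differencing -/

section VanDerCorput

lemma norm_expect_expect_sq_le {X G : Type*} [Fintype X] [Nonempty X] [AddCommGroup G] [Fintype G]
    {b : X → ℂ} (hb : IsOneBounded b) (H : X → G → ℂ) :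
    ‖𝔼 x, b x * 𝔼 y, H x y‖ ^ 2 ≤ 𝔼 t, ‖𝔼 x, 𝔼 y, H x (y + t) * conj (H x y)‖ := by
  refine (norm_expect_mul_sq_le hb).trans ?_
  have h1 : ((𝔼 x, ‖𝔼 y, H x y‖ ^ 2 : ℝ) : ℂ) = 𝔼 t, 𝔼 x, 𝔼 y, H x (y + t) * conj (H x y) := by
    rw [ofReal_expect]
    simp only [norm_expect_sq_shift]
    exact expect_swap _
  refine le_trans (le_abs_self _) ?_
  rw [← Real.norm_eq_abs, ← Complex.norm_real, h1]
  exact norm_expect_le_expect_norm _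

end VanDerCorput

/-! ### Averages along linear forms -/

section Linear

variable {F : Type u} [Field F] [Fintype F]

lemma expect_expect_shift (r : F → F) (H : F → F → ℂ) :
    𝔼 x, 𝔼 y, H x y = 𝔼 x, 𝔼 y, H (x - r y) y := by
  rw [expect_swap, expect_swap (fun x y ↦ H (x - r y) y)]
  exact Finset.expect_congr rfl fun y _ ↦ (expect_sub_right (r y) fun x ↦ H x y).symm

/-- After a translation `g k` is free of `y`, so van der Corput discards it and differentiates the
rest. As `a ≠ c k`, the shift `(a - c k) * t` of `f` ranges over all of `F`, producing the next
Gowers norm. -/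
lemma norm_expect_linear_pow_le {ι : Type*} (S : Finset ι) (a : F) (c : ι → F)
    (hc : ∀ i ∈ S, c i ≠ a) {f : F → ℂ} (hf : IsOneBounded f) {g : ι → F → ℂ}
    (hg : ∀ i, IsOneBounded (g i)) :
    ‖𝔼 x, 𝔼 y, f (x + a * y) * ∏ i ∈ S, g i (x + c i * y)‖ ^ 2 ^ (#S + 1) ≤
      gowersPow #S f := by
  classical
  induction S using Finset.induction_on generalizing a c f g with
  | empty =>
    rw [expect_expect_shift fun y ↦ a * y]
    simp [gowersPow_zero]
  | insert k S hk ih =>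
    rw [Finset.card_insert_of_notMem hk, pow_succ', pow_mul]
    have h1 : 𝔼 x, 𝔼 y, f (x + a * y) * ∏ i ∈ insert k S, g i (x + c i * y) =
        𝔼 x, g k x * 𝔼 y, f (x + (a - c k) * y) * ∏ i ∈ S, g i (x + (c i - c k) * y) := by
      rw [expect_expect_shift fun y ↦ c k * y]
      refine Finset.expect_congr rfl fun x _ ↦ ?_
      rw [Finset.mul_expect]
      refine Finset.expect_congr rfl fun y _ ↦ ?_
      rw [Finset.prod_insert hk, sub_add_cancel, mul_left_comm]
      have : ∀ b, x - c k * y + b * y = x + (b - c k) * y := fun b ↦ by ring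
      simp only [this]
    have h2 := norm_expect_expect_sq_le (hg k)
      (fun x y ↦ f (x + (a - c k) * y) * ∏ i ∈ S, g i (x + (c i - c k) * y))
    rw [h1]
    refine (pow_le_pow_left₀ (by positivity) h2 _).trans ?_
    refine (expect_pow_le (fun _ ↦ norm_nonneg _) _).trans ?_
    have h3 : ∀ t x y : F, (f (x + (a - c k) * (y + t)) *
        ∏ i ∈ S, g i (x + (c i - c k) * (y + t))) *
        conj (f (x + (a - c k) * y) * ∏ i ∈ S, g i (x + (c i - c k) * y)) =
        mulDiff ((a - c k) * t) f (x + (a - c k) * y) *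
          ∏ i ∈ S, mulDiff ((c i - c k) * t) (g i) (x + (c i - c k) * y) := by
      intro t x y
      simp only [mulDiff, map_mul, map_prod, Finset.prod_mul_distrib, mul_add, add_assoc]
      ring
    simp only [h3]
    have hak : a - c k ≠ 0 := sub_ne_zero.2 (hc k (mem_insert_self _ _)).symm
    calc _ ≤ 𝔼 t, gowersPow #S (mulDiff ((a - c k) * t) f) := by
          refine Finset.expect_le_expect fun t _ ↦ ?_
          refine ih (a - c k) (fun i ↦ c i - c k) (fun i hi ↦ ?_) (hf.mulDiff _)
            fun i ↦ (hg i).mulDiff _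
          simpa using hc i (mem_insert_of_mem hi)
      _ = gowersPow (#S + 1) f := by
          rw [gowersPow_succ]
          exact Fintype.expect_equiv (Equiv.mulLeft₀ _ hak) _ _ fun t ↦ rfl

end Linear

/-! ### Degrees of differenced polynomials -/

section Taylor

variable {F : Type u} [Field F]

lemma natCast_ne_zero_of_lt_ringChar {n : ℕ} (hn : n ≠ 0) (h : n < ringChar F) : (n : F) ≠ 0 :=
  fun h0 ↦ hn (Nat.eq_zero_of_dvd_of_lt (ringChar.dvd h0) h)

lemma natDegree_taylor_sub_self_le (t : F) (R : F[X]) :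
    (taylor t R - R).natDegree ≤ R.natDegree - 1 := by
  rw [natDegree_le_iff_coeff_eq_zero]
  intro n hn
  obtain hn | rfl := lt_or_eq_of_le (show R.natDegree ≤ n by omega)
  · rw [coeff_eq_zero_of_natDegree_lt]
    refine (natDegree_sub_le _ _).trans_lt (max_lt ?_ hn)
    rwa [natDegree_taylor]
  · rw [coeff_sub, coeff_taylor_natDegree, sub_eq_zero]
    rfl

lemma coeff_taylor_sub_self (t : F) {R : F[X]} {d : ℕ} (hd : R.natDegree = d + 1) :
    (taylor t R - R).coeff d = (d + 1) * R.leadingCoeff * t := by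
  have h : hasseDeriv d R = C (R.coeff d) + C ((d + 1) * R.coeff (d + 1)) * X := by
    ext n
    rw [hasseDeriv_coeff]
    rcases n with _ | _ | n
    · simp
    · simp [add_comm 1 d]
    · rw [coeff_eq_zero_of_natDegree_lt (by omega)]
      rw [coeff_add, coeff_C_mul, coeff_X]
      simp
  rw [coeff_sub, taylor_coeff, h, leadingCoeff, hd]
  simp

/-- The coefficient just below the top is the degree times the leading coefficient times `t`,
nonzero in large characteristic. -/
lemma natDegree_taylor_sub_self {t : F} (ht : t ≠ 0) {R : F[X]} (hR : R.natDegree < ringChar F) :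
    (taylor t R - R).natDegree = R.natDegree - 1 := by
  refine le_antisymm (natDegree_taylor_sub_self_le t R) ?_
  rcases h : R.natDegree with _ | d
  · simp
  · refine le_natDegree_of_ne_zero ?_
    rw [Nat.add_sub_cancel, coeff_taylor_sub_self t h]
    have h1 : ((d + 1 : ℕ) : F) ≠ 0 := natCast_ne_zero_of_lt_ringChar (by simp) (h ▸ hR)
    have h2 : R.leadingCoeff ≠ 0 := by
      rintro h2
      rw [leadingCoeff_eq_zero] at h2
      simp [h2] at h
    push_cast at h1
    exact mul_ne_zero (mul_ne_zero h1 h2) ht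

lemma natDegree_taylor_sub_taylor {s t : F} (hst : s ≠ t) {R : F[X]}
    (hR : R.natDegree < ringChar F) : (taylor s R - taylor t R).natDegree = R.natDegree - 1 := by
  have : taylor s R - taylor t R = taylor t (taylor (s - t) R - R) := by
    rw [map_sub, taylor_taylor, add_sub_cancel]
  rw [this, natDegree_taylor, natDegree_taylor_sub_self (sub_ne_zero.2 hst) hR]

end Taylor

/-! ### Polynomial averages and one differencing step -/

section PolyAverage

variable {F : Type u} [Field F] [Fintype F] {ι : Type*} [Fintype ι]

/-- The average of `∏ i, g i (x + U i (y))` over `x` and `y`. -/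
noncomputable def polyAverage (U : ι → F[X]) (g : ι → F → ℂ) : ℂ :=
  𝔼 x, 𝔼 y, ∏ i, g i (x + (U i).eval y)

lemma norm_polyAverage_le_one (U : ι → F[X]) {g : ι → F → ℂ} (hg : ∀ i, IsOneBounded (g i)) :
    ‖polyAverage U g‖ ≤ 1 :=
  norm_expect_le_of_forall_le fun x ↦ norm_expect_le_of_forall_le fun y ↦ by
    rw [norm_prod]
    exact Finset.prod_le_one (fun _ _ ↦ norm_nonneg _) fun i _ ↦ hg i _

lemma polyAverage_sub (U : ι → F[X]) (g : ι → F → ℂ) (R : F[X]) :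
    polyAverage (fun i ↦ U i - R) g = polyAverage U g := by
  rw [polyAverage, polyAverage, expect_expect_shift (fun y ↦ R.eval y)
    (fun x y ↦ ∏ i, g i (x + (U i).eval y))]
  simp only [eval_sub, sub_add_eq_add_sub, add_sub_assoc]

open Classical in
/-- The polynomials produced by one van der Corput step with shift `t`, based at `R`. -/
noncomputable def vdcPoly (U : ι → F[X]) (R : F[X]) (t : F) : ι ⊕ ι → F[X] :=
  Sum.elim (fun i ↦ if (U i).natDegree = 0 then 0 else U i - R)
    (fun i ↦ if (U i).natDegree = 0 then 0 else taylor t (U i) - R)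

open Classical in
/-- The functions produced by one van der Corput step. -/
noncomputable def vdcFun (U : ι → F[X]) (g : ι → F → ℂ) : ι ⊕ ι → F → ℂ :=
  Sum.elim (fun i ↦ if (U i).natDegree = 0 then fun _ ↦ 1 else fun x ↦ conj (g i x))
    (fun i ↦ if (U i).natDegree = 0 then fun _ ↦ 1 else g i)

lemma norm_polyAverage_sq_le (U : ι → F[X]) {g : ι → F → ℂ} (hg : ∀ i, IsOneBounded (g i))
    (R : F[X]) : ‖polyAverage U g‖ ^ 2 ≤ 𝔼 t, ‖polyAverage (vdcPoly U R t) (vdcFun U g)‖ := by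
  classical
  -- Factors with constant polynomial depend on `x` alone and are dropped as a weight. Dummy entries
  -- `0` and `1` replace them, keeping the index type `ι ⊕ ι`.
  set b : F → ℂ := fun x ↦ ∏ i, if (U i).natDegree = 0 then g i (x + (U i).coeff 0) else 1
  set H : F → F → ℂ := fun x y ↦
    ∏ i, if (U i).natDegree = 0 then 1 else g i (x + (U i).eval y)
  have hb : IsOneBounded b := IsOneBounded.prod fun i x ↦ by
    split_ifs
    · exact hg i _
    · simp
  have h1 : polyAverage U g = 𝔼 x, b x * 𝔼 y, H x y := by
    refine Finset.expect_congr rfl fun x _ ↦ ?_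
    rw [Finset.mul_expect]
    refine Finset.expect_congr rfl fun y _ ↦ ?_
    rw [← Finset.prod_mul_distrib]
    refine Finset.prod_congr rfl fun i _ ↦ ?_
    split_ifs with h
    · rw [mul_one]
      congr 2
      conv_lhs => rw [eq_C_of_natDegree_eq_zero h, eval_C]
    · rw [one_mul]
  rw [h1]
  refine (norm_expect_expect_sq_le hb H).trans (le_of_eq ?_)
  refine Finset.expect_congr rfl fun t _ ↦ ?_
  rw [polyAverage, expect_expect_shift fun y ↦ R.eval y]
  congr 1
  refine Finset.expect_congr rfl fun x _ ↦ Finset.expect_congr rfl fun y _ ↦ ?_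
  rw [Fintype.prod_sum_type, mul_comm, map_prod]
  congr 1 <;> refine Finset.prod_congr rfl fun i _ ↦ ?_
  · simp only [vdcPoly, vdcFun, Sum.elim_inl]
    split_ifs
    · simp
    · simp [sub_add_eq_add_sub, add_sub_assoc]
  · simp only [vdcPoly, vdcFun, Sum.elim_inr]
    split_ifs
    · simp
    · simp [sub_add_eq_add_sub, add_sub_assoc, taylor_eval]

omit [Fintype F] [Fintype ι] in
lemma isOneBounded_vdcFun (U : ι → F[X]) {g : ι → F → ℂ} (hg : ∀ i, IsOneBounded (g i))
    (i : ι ⊕ ι) : IsOneBounded (vdcFun U g i) := by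
  rcases i with i | i <;> simp only [vdcFun, Sum.elim_inl, Sum.elim_inr] <;> split_ifs
  · exact fun x ↦ by simp
  · exact (hg i).conj
  · exact fun x ↦ by simp
  · exact hg i

end PolyAverage

/-! ### Distinguished members and the type of a system -/

section Systems

variable {F : Type u} [Field F] {ι : Type*}

/-- `U i₀` is nonconstant, has maximal degree, and differs from every other `U i` by a nonconstant
polynomial. -/
structure IsDistinguished (U : ι → F[X]) (i₀ : ι) : Prop where
  natDegree_le : ∀ i, (U i).natDegree ≤ (U i₀).natDegree
  natDegree_pos : 0 < (U i₀).natDegree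
  natDegree_sub_pos : ∀ i ≠ i₀, 0 < (U i₀ - U i).natDegree

open Classical in
/-- The leading coefficients of the polynomials of degree `e` in a system. -/
noncomputable def leadingCoeffs [Fintype ι] (U : ι → F[X]) (e : ℕ) : Finset F :=
  ({i | (U i).natDegree = e} : Finset ι).image fun i ↦ (U i).leadingCoeff

lemma card_leadingCoeffs_le [Fintype ι] (U : ι → F[X]) (e : ℕ) :
    #(leadingCoeffs U e) ≤ Fintype.card ι := by
  classical
  exact card_image_le.trans (card_le_univ _)

/-- The base needs least positive degree, so that the type drops, without spoiling the maximality of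
`U i₀`. Among the nonconstant members whose subtraction preserves the degree of `U i₀`, take one of
least degree: all other nonconstant members have top degree. If there are none, all nonconstant
members share the top term of `U i₀`, and `i₀` itself serves. -/
lemma IsDistinguished.exists_base [Fintype ι] {U : ι → F[X]} {i₀ : ι} (hU : IsDistinguished U i₀) :
    ∃ j, 0 < (U j).natDegree ∧ (∀ i, 0 < (U i).natDegree → (U j).natDegree ≤ (U i).natDegree) ∧
      ((U i₀ - U j).natDegree = (U i₀).natDegree ∨
        (j = i₀ ∧ ∀ i, 0 < (U i).natDegree → (U i₀ - U i).natDegree < (U i₀).natDegree)) := by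
  classical
  have hle : ∀ i, (U i₀ - U i).natDegree ≤ (U i₀).natDegree := fun i ↦
    (natDegree_sub_le _ _).trans (max_le le_rfl (hU.natDegree_le i))
  have hlt : ∀ i, (U i₀ - U i).natDegree < (U i₀).natDegree →
      (U i).natDegree = (U i₀).natDegree := fun i hi ↦ by
    have := natDegree_sub_eq_left_of_natDegree_lt hi
    rwa [sub_sub_cancel] at this
  obtain hS | hS := (({i | 0 < (U i).natDegree ∧ (U i₀ - U i).natDegree = (U i₀).natDegree} :
    Finset ι)).eq_empty_or_nonempty
  · have h : ∀ i, 0 < (U i).natDegree → (U i₀ - U i).natDegree < (U i₀).natDegree := fun i hi ↦ by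
      refine lt_of_le_of_ne (hle i) fun h ↦ ?_
      exact filter_eq_empty_iff.1 hS (mem_univ i) ⟨hi, h⟩
    exact ⟨i₀, hU.natDegree_pos, fun i hi ↦ (hlt i (h i hi)).ge, Or.inr ⟨rfl, h⟩⟩
  · obtain ⟨j, hj, hmin⟩ := exists_min_image _ (fun i ↦ (U i).natDegree) hS
    simp only [mem_filter_univ] at hj hmin
    refine ⟨j, hj.1, fun i hi ↦ ?_, Or.inl hj.2⟩
    obtain h | h := (hle i).lt_or_eq
    · rw [hlt i h]
      exact hU.natDegree_le j
    · exact hmin i ⟨hi, h⟩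

/-- The condition on `t` separates the shifted `U i₀` from unshifted members; separation from
shifted ones is inherited. -/
lemma IsDistinguished.vdcPoly {U : ι → F[X]} {i₀ j : ι} (hU : IsDistinguished U i₀)
    (hD : 2 ≤ (U i₀).natDegree) (hc : (U i₀).natDegree < ringChar F)
    (hj : (U i₀ - U j).natDegree = (U i₀).natDegree ∨
      (j = i₀ ∧ ∀ i, 0 < (U i).natDegree → (U i₀ - U i).natDegree < (U i₀).natDegree))
    {t : F} (ht : ∀ i, (taylor t (U i₀) - U i).natDegree ≠ 0) :
    IsDistinguished (vdcPoly U (U j) t) (Sum.inr i₀) := by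
  have hpos := hU.natDegree_pos
  have hr : ∀ i, (U i).natDegree ≠ 0 →
      _root_.vdcPoly U (U j) t (Sum.inr i) = taylor t (U i) - U j :=
    fun i hi ↦ by simp [_root_.vdcPoly, hi]
  have hl : ∀ i, (U i).natDegree ≠ 0 → _root_.vdcPoly U (U j) t (Sum.inl i) = U i - U j :=
    fun i hi ↦ by simp [_root_.vdcPoly, hi]
  have hr0 : ∀ i, (U i).natDegree = 0 → _root_.vdcPoly U (U j) t (Sum.inr i) = 0 :=
    fun i hi ↦ by simp [_root_.vdcPoly, hi]
  have hl0 : ∀ i, (U i).natDegree = 0 → _root_.vdcPoly U (U j) t (Sum.inl i) = 0 :=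
    fun i hi ↦ by simp [_root_.vdcPoly, hi]
  have hi₀ := hr i₀ hpos.ne'
  refine ⟨?_, ?_, ?_⟩
  · rw [hi₀]
    obtain h | ⟨rfl, h⟩ := hj
    · have h1 : (taylor t (U i₀) - U j).natDegree = (U i₀).natDegree := by
        have h2 : taylor t (U i₀) - U j = (U i₀ - U j) + (taylor t (U i₀) - U i₀) := by ring
        rw [h2, natDegree_add_eq_left_of_natDegree_lt, h]
        rw [h]
        exact (natDegree_taylor_sub_self_le _ _).trans_lt (by omega)
      rw [h1]
      rintro (i | i) <;> by_cases hi : (U i).natDegree = 0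
      · simp [hl0 i hi]
      · rw [hl i hi]
        exact (natDegree_sub_le _ _).trans (max_le (hU.natDegree_le i) (hU.natDegree_le j))
      · simp [hr0 i hi]
      · rw [hr i hi]
        refine (natDegree_sub_le _ _).trans (max_le ?_ (hU.natDegree_le j))
        rw [natDegree_taylor]
        exact hU.natDegree_le i
    -- All nonconstant members share one top term. Their differences lose at least one degree, while
    -- differencing `U j` loses exactly one, so maximality persists.
    · have ht0 : t ≠ 0 := by
        rintro rfl
        exact ht j (by simp)
      rw [natDegree_taylor_sub_self ht0 hc]
      have h2 : ∀ i, (U i).natDegree ≠ 0 → (U i - U j).natDegree ≤ (U j).natDegree - 1 := by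
        intro i hi
        rw [natDegree_sub]
        exact Nat.le_sub_one_of_lt (h i (Nat.pos_of_ne_zero hi))
      rintro (i | i) <;> by_cases hi : (U i).natDegree = 0
      · simp [hl0 i hi]
      · rw [hl i hi]
        exact h2 i hi
      · simp [hr0 i hi]
      · rw [hr i hi]
        have h3 : taylor t (U i) - U j = taylor t (U i - U j) + (taylor t (U j) - U j) := by
          rw [map_sub]; ring
        rw [h3]
        refine (natDegree_add_le _ _).trans (max_le ?_ (natDegree_taylor_sub_self_le _ _))
        rw [natDegree_taylor]
        exact h2 i hi
  · rw [hi₀]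
    exact Nat.pos_of_ne_zero (ht j)
  · rw [hi₀]
    rintro (i | i) hne <;> by_cases hi : (U i).natDegree = 0
    · rw [hl0 i hi, sub_zero]
      exact Nat.pos_of_ne_zero (ht j)
    · rw [hl i hi, sub_sub_sub_cancel_right]
      exact Nat.pos_of_ne_zero (ht i)
    · rw [hr0 i hi, sub_zero]
      exact Nat.pos_of_ne_zero (ht j)
    · rw [hr i hi, sub_sub_sub_cancel_right, ← map_sub, natDegree_taylor]
      exact hU.natDegree_sub_pos i fun h ↦ hne (by rw [h])

/-- Each `i` excludes at most one shift: two distinct translates of `R` differ by a polynomial of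
degree at least one. -/
lemma card_natDegree_taylor_sub_eq_zero_le [Fintype F] [Fintype ι] [DecidableEq F] {R : F[X]}
    (hR : 2 ≤ R.natDegree) (hc : R.natDegree < ringChar F) (U : ι → F[X]) :
    #{t : F | ∃ i, (taylor t R - U i).natDegree = 0} ≤ Fintype.card ι := by
  classical
  have h1 : ({t : F | ∃ i, (taylor t R - U i).natDegree = 0} : Finset F) =
      univ.biUnion fun i ↦ {t : F | (taylor t R - U i).natDegree = 0} := by
    ext t; simp
  rw [h1]
  refine (card_biUnion_le_card_mul _ _ 1 fun i _ ↦ card_le_one.2 fun s hs t ht ↦ ?_).trans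
    (by simp)
  simp only [mem_filter_univ] at hs ht
  by_contra hst
  have h2 := natDegree_taylor_sub_taylor hst hc
  have h3 : (taylor s R - taylor t R).natDegree ≤ 0 := by
    rw [← sub_sub_sub_cancel_right _ _ (U i)]
    exact (natDegree_sub_le _ _).trans (by simp [hs, ht])
  omega

lemma natDegree_leadingCoeff_of_sub_lt {V R : F[X]} (h : R.natDegree < (V - R).natDegree) :
    V.natDegree = (V - R).natDegree ∧ V.leadingCoeff = (V - R).leadingCoeff := by
  have h1 : V = (V - R) + R := by ring
  constructor
  · conv_lhs => rw [h1]
    exact natDegree_add_eq_left_of_natDegree_lt h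
  · conv_lhs => rw [h1]
    exact leadingCoeff_add_of_degree_lt' (degree_lt_degree h)

lemma leadingCoeff_sub_of_natDegree_eq {V R : F[X]} (hR : 0 < R.natDegree)
    (hVR : R.natDegree ≤ V.natDegree) (h : (V - R).natDegree = R.natDegree) :
    V.natDegree = R.natDegree ∧ (V - R).leadingCoeff = V.leadingCoeff - R.leadingCoeff ∧
      V.leadingCoeff ≠ R.leadingCoeff := by
  have h1 : V.natDegree = R.natDegree := by
    refine le_antisymm ?_ hVR
    rw [show V = (V - R) + R by ring]
    exact (natDegree_add_le _ _).trans (by simp [h])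
  have h2 : (V - R).leadingCoeff = V.leadingCoeff - R.leadingCoeff := by
    rw [leadingCoeff, h, coeff_sub, leadingCoeff, leadingCoeff, h1]
  refine ⟨h1, h2, fun h3 ↦ ?_⟩
  rw [h3, sub_self, leadingCoeff_eq_zero] at h2
  rw [h2] at h
  simp at h
  omega

/-- Above the degree of the base, leading coefficients are unaffected. In that degree they are
translated and the base's own one disappears. Below it, the number of indices is a sufficient bound.
-/
lemma card_leadingCoeffs_vdcPoly_le [Fintype ι] {U : ι → F[X]} {j : ι} (hj : 0 < (U j).natDegree)
    (hmin : ∀ i, 0 < (U i).natDegree → (U j).natDegree ≤ (U i).natDegree) {W : Multiset ℕ}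
    (hW : ∀ e, 0 < e → #(leadingCoeffs U e) ≤ W.count e) (t : F) {e : ℕ} (he : 0 < e) :
    #(leadingCoeffs (vdcPoly U (U j) t) e) ≤ (W.erase (U j).natDegree +
      (2 * Fintype.card ι) • Multiset.range (U j).natDegree).count e := by
  classical
  have key : ∀ c ∈ leadingCoeffs (vdcPoly U (U j) t) e, ∃ i, ∃ V : F[X],
      V.natDegree = (U i).natDegree ∧ V.leadingCoeff = (U i).leadingCoeff ∧
      0 < (U i).natDegree ∧ (V - U j).natDegree = e ∧ (V - U j).leadingCoeff = c := by
    intro c hc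
    simp only [leadingCoeffs, mem_image, mem_filter_univ] at hc
    obtain ⟨i | i, h1, h2⟩ := hc <;> simp only [vdcPoly, Sum.elim_inl, Sum.elim_inr] at h1 h2 <;>
      split_ifs at h1 h2 with hi
    · simp at h1; omega
    · exact ⟨i, U i, rfl, rfl, Nat.pos_of_ne_zero hi, h1, h2⟩
    · simp at h1; omega
    · exact ⟨i, taylor t (U i), natDegree_taylor _ _, leadingCoeff_taylor _ _,
        Nat.pos_of_ne_zero hi, h1, h2⟩
  rw [Multiset.count_add, Multiset.count_nsmul]
  obtain h | h | h := lt_trichotomy e (U j).natDegree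
  · have : (Multiset.range (U j).natDegree).count e = 1 :=
      Multiset.count_eq_one_of_mem (Multiset.nodup_range _) (Multiset.mem_range.2 h)
    rw [this, mul_one]
    refine le_add_left ((card_leadingCoeffs_le _ _).trans ?_)
    rw [Fintype.card_sum]
    omega
  · subst h
    rw [Multiset.count_erase_self]
    have h1 : leadingCoeffs (vdcPoly U (U j) t) (U j).natDegree ⊆
        ((leadingCoeffs U (U j).natDegree).erase (U j).leadingCoeff).image
          (· - (U j).leadingCoeff) := by
      intro c hc
      obtain ⟨i, V, hV1, hV2, hi, h1, h2⟩ := key c hc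
      obtain ⟨h3, h4, h5⟩ := leadingCoeff_sub_of_natDegree_eq hj (hV1 ▸ hmin i hi) h1
      refine mem_image.2 ⟨V.leadingCoeff, mem_erase.2 ⟨h5, ?_⟩, by rw [← h4, h2]⟩
      exact mem_image.2 ⟨i, by simp [← hV1, h3], hV2.symm⟩
    have h2 : (U j).leadingCoeff ∈ leadingCoeffs U (U j).natDegree :=
      mem_image.2 ⟨j, by simp, rfl⟩
    refine (card_le_card h1).trans (card_image_le.trans ?_)
    rw [card_erase_of_mem h2]
    have := hW _ hj
    omega
  · rw [Multiset.count_erase_of_ne h.ne']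
    refine le_add_right ((card_le_card fun c hc ↦ ?_).trans (hW e he))
    obtain ⟨i, V, hV1, hV2, hi, rfl, h2⟩ := key c hc
    obtain ⟨h3, h4⟩ := natDegree_leadingCoeff_of_sub_lt h
    exact mem_image.2 ⟨i, by simp [← hV1, h3], by rw [← hV2, h4, h2]⟩

end Systems

/-! ### PET induction -/

/-- Control of polynomial averages of systems of a given type by a Gowers norm of the distinguished
function. The multiset `W` bounds the number of leading coefficients in each degree. -/
def HasGowersBound (D : ℕ) (W : Multiset ℕ) (ι : Type) [Fintype ι] (M K : ℕ) : Prop :=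
  ∀ (F : Type u) [Field F] [Fintype F], D < ringChar F →
    ∀ (U : ι → F[X]) (i₀ : ι) (g : ι → F → ℂ), IsDistinguished U i₀ → (U i₀).natDegree ≤ D →
      (∀ e, 0 < e → #(leadingCoeffs U e) ≤ W.count e) → (∀ i, IsOneBounded (g i)) →
      ‖polyAverage U g‖ ^ M ≤ M * ((Fintype.card F : ℝ)⁻¹ + gowersPow K (g i₀))

/-- With `M` both exponent and constant, any larger value also works, so finitely many bounds can be
merged. -/
lemma exists_bound_gowersPow_of_le {M K K' : ℕ} (hK : K ≤ K') :
    ∃ M₀ : ℕ, ∀ M' ≥ M₀, ∀ {G : Type u} [AddCommGroup G] [Fintype G] {f : G → ℂ} {L η : ℝ},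
      0 ≤ L → L ≤ 1 → 0 ≤ η → η ≤ 1 → L ^ M ≤ M * (η + gowersPow K f) →
      L ^ M' ≤ M' * (η + gowersPow K' f) := by
  induction K', hK using Nat.le_induction with
  | base =>
    refine ⟨M, fun M' hM' G _ _ f L η h0 h1 h2 _ h ↦ ?_⟩
    have := gowersPow_nonneg K f
    calc L ^ M' ≤ L ^ M := pow_le_pow_of_le_one h0 h1 hM'
      _ ≤ M * (η + gowersPow K f) := h
      _ ≤ M' * (η + gowersPow K f) := by gcongr
  | succ K' hK ih =>
    obtain ⟨M₀, ih⟩ := ih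
    -- The first summand covers the exponent after squaring, the second the resulting constant.
    refine ⟨2 * M₀ + 2 * M₀ ^ 2, fun M' hM' G _ _ f L η h0 h1 h2 h3 h ↦ ?_⟩
    have h4 := ih M₀ le_rfl h0 h1 h2 h3 h
    have h5 := gowersPow_nonneg K' f
    have h6 := gowersPow_nonneg (K' + 1) f
    have h7 := gowersPow_sq_le K' f
    calc L ^ M' ≤ L ^ (M₀ * 2) := pow_le_pow_of_le_one h0 h1 (by nlinarith)
      _ = (L ^ M₀) ^ 2 := pow_mul _ _ _
      _ ≤ (M₀ * (η + gowersPow K' f)) ^ 2 := by gcongr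
      _ = M₀ ^ 2 * (η + gowersPow K' f) ^ 2 := mul_pow _ _ _
      _ ≤ M₀ ^ 2 * (2 * (η + gowersPow (K' + 1) f)) := by
        gcongr
        nlinarith [sq_nonneg (η - gowersPow K' f)]
      _ = (2 * M₀ ^ 2 : ℕ) * (η + gowersPow (K' + 1) f) := by push_cast; ring
      _ ≤ M' * (η + gowersPow (K' + 1) f) := by
        gcongr
        omega

lemma inv_card_le_one (F : Type*) [Fintype F] : (Fintype.card F : ℝ)⁻¹ ≤ 1 := by
  rcases Nat.eq_zero_or_pos (Fintype.card F) with h | h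
  · simp [h]
  · exact inv_le_one_of_one_le₀ (by exact_mod_cast h)

lemma HasGowersBound.exists_of_le {D : ℕ} {W : Multiset ℕ} {ι : Type} [Fintype ι] {M K K' : ℕ}
    (h : HasGowersBound.{u} D W ι M K) (hK : K ≤ K') :
    ∃ M₀ : ℕ, ∀ M' ≥ M₀, HasGowersBound.{u} D W ι M' K' := by
  obtain ⟨M₀, hM₀⟩ := exists_bound_gowersPow_of_le.{u} (M := M) hK
  exact ⟨M₀, fun M' hM' F _ _ hF U i₀ g hU hD hW hg ↦ hM₀ M' hM' (norm_nonneg _)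
    (norm_polyAverage_le_one U hg) (by positivity) (inv_card_le_one F) (h F hF U i₀ g hU hD hW hg)⟩

lemma exists_common_hasGowersBound {D : ℕ} {ι : Type} [Fintype ι] (s : Finset ℕ)
    (W : ℕ → Multiset ℕ) (h : ∀ d ∈ s, ∃ M K, 0 < M ∧ HasGowersBound.{u} D (W d) ι M K) :
    ∃ M K, 0 < M ∧ ∀ d ∈ s, HasGowersBound.{u} D (W d) ι M K := by
  choose! M K hM h using h
  have h' : ∀ d ∈ s, ∃ M₀ : ℕ, ∀ M' ≥ M₀, HasGowersBound.{u} D (W d) ι M' (s.sup K) :=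
    fun d hd ↦ (h d hd).exists_of_le (le_sup hd)
  choose! M₀ hM₀ using h'
  exact ⟨s.sup M₀ + 1, s.sup K, Nat.succ_pos _, fun d hd ↦ hM₀ d hd _
    ((le_sup (f := M₀) hd).trans (Nat.le_succ _))⟩

lemma polyAverage_linear_bound {F : Type u} [Field F] [Fintype F] {ι : Type} [Fintype ι]
    {U : ι → F[X]} {i₀ : ι} {g : ι → F → ℂ} (hU : IsDistinguished U i₀)
    (hD : (U i₀).natDegree ≤ 1) (hg : ∀ i, IsOneBounded (g i)) :
    ‖polyAverage U g‖ ^ 2 ^ Fintype.card ι ≤ gowersPow (Fintype.card ι - 1) (g i₀) := by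
  classical
  have heval : ∀ i y, (U i).eval y = (U i).coeff 0 + (U i).coeff 1 * y := fun i y ↦ by
    have h1 : (U i).natDegree < 2 := by have := hU.natDegree_le i; omega
    rw [eval_eq_sum_range' h1]
    simp [Finset.sum_range_succ]
  have hne : ∀ i ∈ univ.erase i₀, (U i).coeff 1 ≠ (U i₀).coeff 1 := fun i hi h ↦ by
    have h1 := hU.natDegree_sub_pos i (ne_of_mem_erase hi)
    have h2 : (U i₀ - U i).natDegree ≤ 0 := by
      rw [natDegree_le_iff_coeff_eq_zero]
      intro n hn
      rcases eq_or_ne n 1 with rfl | hn1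
      · rw [coeff_sub, h, sub_self]
      · apply coeff_eq_zero_of_natDegree_lt
        have := hU.natDegree_le i
        refine (natDegree_sub_le _ _).trans_lt (max_lt ?_ ?_) <;> omega
    omega
  have h1 := norm_expect_linear_pow_le (univ.erase i₀) ((U i₀).coeff 1) (fun i ↦ (U i).coeff 1) hne
    ((hg i₀).comp (· + (U i₀).coeff 0)) (g := fun i x ↦ g i (x + (U i).coeff 0))
    (fun i ↦ (hg i).comp (· + (U i).coeff 0))
  have hcard : #(univ.erase i₀) = Fintype.card ι - 1 := by
    rw [card_erase_of_mem (mem_univ _), card_univ]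
  have hpos : 0 < Fintype.card ι := Fintype.card_pos_iff.2 ⟨i₀⟩
  rw [hcard, gowersPow_comp_add, Nat.sub_add_cancel hpos] at h1
  refine le_trans (le_of_eq ?_) h1
  congr 2
  refine Finset.expect_congr rfl fun x _ ↦ Finset.expect_congr rfl fun y _ ↦ ?_
  rw [← Finset.mul_prod_erase _ _ (mem_univ i₀)]
  simp only [heval]
  have : ∀ i, x + ((U i).coeff 0 + (U i).coeff 1 * y) = x + (U i).coeff 1 * y + (U i).coeff 0 :=
    fun i ↦ by ring
  simp only [this]

/-- Each bad shift costs at most `1`; as there are at most `Fintype.card ι` of them, their share is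
absorbed by the `1 / q` term. -/
lemma polyAverage_bound_of_vdc {F : Type u} [Field F] [Fintype F] {ι : Type} [Fintype ι]
    {U : ι → F[X]} {i₀ j : ι} {g : ι → F → ℂ} (hD : 2 ≤ (U i₀).natDegree)
    (hc : (U i₀).natDegree < ringChar F) (hg : ∀ i, IsOneBounded (g i)) {M K : ℕ}
    (h : ∀ t, (∀ i, (taylor t (U i₀) - U i).natDegree ≠ 0) →
      ‖polyAverage (vdcPoly U (U j) t) (vdcFun U g)‖ ^ M ≤
        M * ((Fintype.card F : ℝ)⁻¹ + gowersPow K (g i₀))) :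
    ‖polyAverage U g‖ ^ (2 * (M + Fintype.card ι)) ≤ (2 * (M + Fintype.card ι) : ℕ) *
      ((Fintype.card F : ℝ)⁻¹ + gowersPow K (g i₀)) := by
  classical
  set η := (Fintype.card F : ℝ)⁻¹ with hη
  set N := gowersPow K (g i₀)
  have hη0 : 0 ≤ η := by positivity
  have hN : 0 ≤ N := gowersPow_nonneg _ _
  set bad : Finset F := {t : F | ∃ i, (taylor t (U i₀) - U i).natDegree = 0}
  have hbad : #bad ≤ Fintype.card ι := card_natDegree_taylor_sub_eq_zero_le hD hc U
  have hg' := isOneBounded_vdcFun U hg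
  calc ‖polyAverage U g‖ ^ (2 * (M + Fintype.card ι)) ≤ ‖polyAverage U g‖ ^ (2 * M) :=
        pow_le_pow_of_le_one (norm_nonneg _) (norm_polyAverage_le_one U hg) (by omega)
    _ ≤ (𝔼 t, ‖polyAverage (vdcPoly U (U j) t) (vdcFun U g)‖) ^ M := by
        rw [pow_mul]
        exact pow_le_pow_left₀ (by positivity) (norm_polyAverage_sq_le U hg (U j)) _
    _ ≤ 𝔼 t, ‖polyAverage (vdcPoly U (U j) t) (vdcFun U g)‖ ^ M :=
        expect_pow_le (fun _ ↦ norm_nonneg _) _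
    _ ≤ 𝔼 t, ((if t ∈ bad then 1 else 0) + M * (η + N)) := by
        refine Finset.expect_le_expect fun t _ ↦ ?_
        split_ifs with ht
        · have : 0 ≤ M * (η + N) := by positivity
          have := pow_le_one₀ (n := M) (norm_nonneg _)
            (norm_polyAverage_le_one (vdcPoly U (U j) t) hg')
          linarith
        · rw [zero_add]
          refine h t fun i hi ↦ ht ?_
          simp only [bad, mem_filter_univ]
          exact ⟨i, hi⟩
    _ = #bad * η + M * (η + N) := by
        rw [Finset.expect_add_distrib, Fintype.expect_const, Fintype.expect_eq_sum_div_card]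
        simp [hη, div_eq_mul_inv]
    _ ≤ Fintype.card ι * η + M * (η + N) := by gcongr
    _ ≤ (2 * (M + Fintype.card ι) : ℕ) * (η + N) := by
        push_cast
        nlinarith [mul_nonneg (Nat.cast_nonneg (α := ℝ) (Fintype.card ι)) hη0,
          mul_nonneg (Nat.cast_nonneg (α := ℝ) (Fintype.card ι)) hN,
          mul_nonneg (Nat.cast_nonneg (α := ℝ) M) (add_nonneg hη0 hN)]

/-- PET induction. -/
lemma exists_hasGowersBound (D : ℕ) (W : Multiset ℕ) : ∀ (ι : Type) [Fintype ι],
    ∃ M K, 0 < M ∧ HasGowersBound.{u} D W ι M K := by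
  induction W using (WellFounded.cutExpand (r := ((· < ·) : ℕ → ℕ → Prop)) wellFounded_lt).induction
  case h W ih =>
  intro ι _
  classical
  -- The degree of the base depends on the system but lies in `W`, so the bounds for all possible
  -- successor types are merged in advance. Each successor trades one `d` for smaller degrees.
  obtain ⟨M, K, hM, hMK⟩ := exists_common_hasGowersBound.{u} (D := D) (ι := ι ⊕ ι) W.toFinset
    (fun d ↦ W.erase d + (2 * Fintype.card ι) • Multiset.range d) (fun d hd ↦ by
      refine ih _ ⟨(2 * Fintype.card ι) • Multiset.range d, d, fun a ha ↦ ?_, ?_⟩ (ι ⊕ ι)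
      · exact Multiset.mem_range.1 (Multiset.mem_of_mem_nsmul ha)
      · rw [add_right_comm, add_comm (W.erase d), Multiset.singleton_add,
          Multiset.cons_erase (Multiset.mem_toFinset.1 hd)])
  set n := Fintype.card ι
  obtain ⟨M₁, hM₁⟩ := exists_bound_gowersPow_of_le.{u} (M := 2 * (M + n)) (K := K)
    (K' := max K (n - 1)) (le_max_left _ _)
  obtain ⟨M₂, hM₂⟩ := exists_bound_gowersPow_of_le.{u} (M := 2 ^ n) (K := n - 1)
    (K' := max K (n - 1)) (le_max_right _ _)
  refine ⟨M₁ + M₂ + 1, max K (n - 1), Nat.succ_pos _, fun F _ _ hF U i₀ g hU hD hW hg ↦ ?_⟩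
  have hη0 : 0 ≤ (Fintype.card F : ℝ)⁻¹ := by positivity
  have hη1 := inv_card_le_one F
  have hL := norm_polyAverage_le_one U hg
  obtain h1 | h1 := le_or_gt (U i₀).natDegree 1
  · refine hM₂ _ (by omega) (norm_nonneg _) hL hη0 hη1 ?_
    refine (polyAverage_linear_bound hU h1 hg).trans ?_
    have h2 := gowersPow_nonneg (n - 1) (g i₀)
    have h3 : (1 : ℝ) ≤ (2 ^ n : ℕ) := by exact_mod_cast Nat.one_le_two_pow
    nlinarith
  · refine hM₁ _ (by omega) (norm_nonneg _) hL hη0 hη1 ?_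
    obtain ⟨j, hj, hmin, hj'⟩ := hU.exists_base
    refine polyAverage_bound_of_vdc (j := j) h1 (hD.trans_lt hF) hg fun t ht ↦ ?_
    have hU' := hU.vdcPoly h1 (hD.trans_lt hF) hj' ht
    have hdW : (U j).natDegree ∈ W.toFinset := by
      rw [Multiset.mem_toFinset, ← Multiset.count_pos]
      refine lt_of_lt_of_le ?_ (hW _ hj)
      exact card_pos.2 ⟨_, mem_image.2 ⟨j, by simp, rfl⟩⟩
    have h2 := hMK _ hdW F hF _ (Sum.inr i₀) (vdcFun U g) hU' ?_
      (fun e he ↦ card_leadingCoeffs_vdcPoly_le hj hmin hW t he) (isOneBounded_vdcFun U hg)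
    · have : vdcFun U g (Sum.inr i₀) = g i₀ := by simp [vdcFun, hU.natDegree_pos.ne']
      rwa [this] at h2
    · have : vdcPoly U (U j) t (Sum.inr i₀) = taylor t (U i₀) - U j := by
        simp [vdcPoly, hU.natDegree_pos.ne']
      rw [this]
      refine (natDegree_sub_le _ _).trans (max_le ?_ ((hU.natDegree_le j).trans hD))
      rwa [natDegree_taylor]

/-- Polynomial averages are controlled by a Gowers norm of any function whose polynomial differs
from all the others by nonconstant polynomials. -/
theorem exists_polyAverage_pow_le (D : ℕ) (ι : Type) [Fintype ι] : ∃ M K : ℕ, 0 < M ∧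
    ∀ (F : Type u) [Field F] [Fintype F], D < ringChar F →
    ∀ (U : ι → F[X]) (i₀ : ι) (g : ι → F → ℂ), (∀ i, (U i).natDegree ≤ D) →
      0 < (U i₀).natDegree → (∀ i ≠ i₀, 0 < (U i₀ - U i).natDegree) →
      (∀ i, IsOneBounded (g i)) →
      ‖polyAverage U g‖ ^ M ≤ M * ((Fintype.card F : ℝ)⁻¹ + gowersPow K (g i₀)) := by
  classical
  obtain ⟨M, K, hM, h⟩ := exists_hasGowersBound.{u} D
    (Fintype.card ι • Multiset.range (D + 1)) ι
  refine ⟨M, K, hM, fun F _ _ hF U i₀ g hD hi₀ hsub hg ↦ ?_⟩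
  have hW : ∀ V : ι → F[X], (∀ i, (V i).natDegree ≤ D) → ∀ e, 0 < e →
      #(leadingCoeffs V e) ≤ (Fintype.card ι • Multiset.range (D + 1)).count e := by
    intro V hV e _
    rw [Multiset.count_nsmul]
    obtain he | he := le_or_gt e D
    · have : (Multiset.range (D + 1)).count e = 1 :=
        Multiset.count_eq_one_of_mem (Multiset.nodup_range _) (Multiset.mem_range.2 (by omega))
      rw [this, mul_one]
      exact card_leadingCoeffs_le _ _
    · have : leadingCoeffs V e = ∅ := by
        refine image_eq_empty.2 (filter_eq_empty_iff.2 fun i _ ↦ ?_)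
        have := hV i
        omega
      simp [this]
  have : Nonempty ι := ⟨i₀⟩
  obtain ⟨k, hk⟩ := Finite.exists_max fun i ↦ (U i).natDegree
  obtain hlt | heq := (hk i₀).lt_or_eq
  -- Subtracting a member of top degree from all of them gives `U i₀` top degree too.
  · rw [← polyAverage_sub U g (U k)]
    have hV : ∀ i, (U i - U k).natDegree ≤ (U k).natDegree := fun i ↦
      (natDegree_sub_le _ _).trans (max_le (hk i) le_rfl)
    have hV0 : (U i₀ - U k).natDegree = (U k).natDegree :=
      natDegree_sub_eq_right_of_natDegree_lt hlt
    refine h F hF _ i₀ g ⟨fun i ↦ ?_, ?_, fun i hi ↦ ?_⟩ ((hV i₀).trans (hD k))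
      (hW _ fun i ↦ (hV i).trans (hD k)) hg
    · rw [hV0]
      exact hV i
    · rw [hV0]
      omega
    · rw [sub_sub_sub_cancel_right]
      exact hsub i hi
  · exact h F hF U i₀ g ⟨fun i ↦ heq ▸ hk i, hi₀, hsub⟩ (hD i₀) (hW U hD) hg

/-! ### Exponential sums -/

section Weyl

variable {F : Type u} [Field F] [Fintype F]

lemma expect_addChar_eq_zero {χ : AddChar F ℂ} (hχ : χ ≠ 1) : 𝔼 y, χ y = 0 := by
  rw [Fintype.expect_eq_sum_div_card, AddChar.sum_eq_zero_of_ne_one hχ, zero_div]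

/-- Weyl's inequality. -/
lemma norm_expect_addChar_eval_pow_le {χ : AddChar F ℂ} (hχ : χ ≠ 1) (d : ℕ) {R : F[X]}
    (hd : R.natDegree = d + 1) (hc : d + 1 < ringChar F) :
    ‖𝔼 y, χ (R.eval y)‖ ^ 2 ^ (d + 1) ≤ (d + 1) * (Fintype.card F : ℝ)⁻¹ := by
  classical
  induction d generalizing R with
  | zero =>
    have h1 : R.coeff 1 ≠ 0 := by
      have : R.leadingCoeff ≠ 0 := leadingCoeff_ne_zero.2 fun h ↦ by simp [h] at hd
      rwa [leadingCoeff, hd] at this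
    have h2 : ∀ y, R.eval y = R.coeff 0 + R.coeff 1 * y := fun y ↦ by
      rw [eval_eq_sum_range, hd]
      simp [Finset.sum_range_succ]
    have h3 : 𝔼 y, χ (R.coeff 1 * y) = 𝔼 y, χ y :=
      Fintype.expect_equiv (Equiv.mulLeft₀ _ h1) _ _ fun y ↦ rfl
    simp only [h2, AddChar.map_add_eq_mul]
    rw [← Finset.mul_expect, h3, expect_addChar_eq_zero hχ]
    simp
  | succ d ih =>
    have h1 : ‖𝔼 y, χ (R.eval y)‖ ^ 2 ≤ 𝔼 t, ‖𝔼 y, χ ((taylor t R - R).eval y)‖ := by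
      have h2 := norm_expect_sq_shift fun y ↦ χ (R.eval y)
      have h3 : ∀ t y, χ (R.eval (y + t)) * conj (χ (R.eval y)) =
          χ ((taylor t R - R).eval y) := fun t y ↦ by
        rw [eval_sub, taylor_eval, sub_eq_add_neg, AddChar.map_add_eq_mul, AddChar.map_neg_eq_conj]
      simp only [h3] at h2
      refine le_trans (le_abs_self _) ?_
      rw [← Real.norm_eq_abs, ← Complex.norm_real, h2]
      exact norm_expect_le_expect_norm _
    rw [pow_succ', pow_mul]
    calc _ ≤ (𝔼 t, ‖𝔼 y, χ ((taylor t R - R).eval y)‖) ^ 2 ^ (d + 1) :=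
          pow_le_pow_left₀ (by positivity) h1 _
      _ ≤ 𝔼 t, ‖𝔼 y, χ ((taylor t R - R).eval y)‖ ^ 2 ^ (d + 1) :=
          expect_pow_le (fun _ ↦ norm_nonneg _) _
      -- The shift `t = 0` contributes one extra `1 / q`, which raises the constant by one.
      _ ≤ 𝔼 t : F, ((if t = 0 then 1 else 0) + (d + 1) * (Fintype.card F : ℝ)⁻¹) := by
          refine Finset.expect_le_expect fun t _ ↦ ?_
          split_ifs with ht
          · have : 0 ≤ (d + 1) * (Fintype.card F : ℝ)⁻¹ := by positivity
            have := pow_le_one₀ (n := 2 ^ (d + 1)) (norm_nonneg (𝔼 y, χ ((taylor t R - R).eval y)))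
              (norm_expect_le_of_forall_le fun y ↦ by rw [AddChar.norm_apply])
            linarith
          · rw [zero_add]
            refine ih ?_ (by omega)
            rw [natDegree_taylor_sub_self ht (hd ▸ hc), hd, Nat.add_sub_cancel]
      _ = _ := by
          rw [Finset.expect_add_distrib, Fintype.expect_const, Fintype.expect_eq_sum_div_card]
          simp only [Finset.sum_ite_eq', Finset.mem_univ, if_true]
          push_cast
          ring

/-- Dilating a nontrivial character is injective, and there are as many characters as field
elements. -/
lemma exists_eq_mulShift (F : Type u) [Field F] [Fintype F] :
    ∃ e : AddChar F ℂ, e ≠ 1 ∧ ∀ ψ : AddChar F ℂ, ∃ a : F, ψ = AddChar.mulShift e a := by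
  classical
  obtain ⟨e, he⟩ : ∃ e : AddChar F ℂ, e ≠ 1 := by
    obtain ⟨e, he⟩ := AddChar.exists_apply_ne_zero.2 (one_ne_zero (α := F))
    exact ⟨e, fun h ↦ he (by simp [h])⟩
  have hinj := AddChar.to_mulShift_inj_of_isPrimitive (AddChar.IsPrimitive.of_ne_one he)
  have hbij := (Fintype.bijective_iff_injective_and_card _).2 ⟨hinj, AddChar.card_eq.symm⟩
  exact ⟨e, he, fun ψ ↦ (hbij.2 ψ).imp fun a ha ↦ ha.symm⟩

lemma norm_expect_prod_addChar_pow_le {n D : ℕ} (hD : D < ringChar F) {Q : Fin n → F[X]}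
    (hQ0 : ∀ j, (Q j).coeff 0 = 0) (hQD : ∀ j, (Q j).natDegree ≤ D) (hQ : LinearIndependent F Q)
    {ψ : Fin n → AddChar F ℂ} (hψ : ¬ ∀ j, ψ j = 1) :
    ‖𝔼 y, ∏ j, ψ j ((Q j).eval y)‖ ^ 2 ^ D ≤ D * (Fintype.card F : ℝ)⁻¹ := by
  obtain ⟨e, he, h⟩ := exists_eq_mulShift F
  choose a ha using fun j ↦ h (ψ j)
  set R : F[X] := ∑ j, a j • Q j with hR
  have h1 : ∀ y, ∏ j, ψ j ((Q j).eval y) = e (R.eval y) := fun y ↦ by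
    simp only [hR, eval_finsetSum, ha, AddChar.mulShift_apply, eval_smul, smul_eq_mul]
    exact (map_prod e.toMonoidHom (fun j ↦ Multiplicative.ofAdd (a j * (Q j).eval y)) univ).symm
  have h2 : R ≠ 0 := fun h0 ↦ hψ fun j ↦ by
    rw [ha j, Fintype.linearIndependent_iff.1 hQ a h0 j, AddChar.mulShift_zero]
  have h3 : R.natDegree ≠ 0 := fun h0 ↦ h2 <| by
    rw [eq_C_of_natDegree_eq_zero h0, hR, finsetSum_coeff]
    simp [hQ0]
  have h4 : R.natDegree ≤ D := natDegree_sum_le_of_forall_le _ _ fun j _ ↦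
    (natDegree_smul_le _ _).trans (hQD j)
  obtain ⟨d, hd⟩ := Nat.exists_eq_succ_of_ne_zero h3
  simp only [h1]
  calc _ ≤ ‖𝔼 y, e (R.eval y)‖ ^ 2 ^ (d + 1) := by
        refine pow_le_pow_of_le_one (norm_nonneg _)
          (norm_expect_le_of_forall_le fun y ↦ by rw [AddChar.norm_apply]) ?_
        exact Nat.pow_le_pow_right (by norm_num) (by omega)
    _ ≤ (d + 1) * (Fintype.card F : ℝ)⁻¹ := norm_expect_addChar_eval_pow_le he d hd (by omega)
    _ ≤ _ := by
        gcongr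
        exact_mod_cast (show d + 1 ≤ D by omega)

end Weyl

/-- Brings two power savings to a common exponent; surplus powers of `η ≤ 1` are dropped. -/
lemma add_pow_mul_le {e₁ e₂ A B η : ℝ} {a b : ℕ} (h₁ : 0 ≤ e₁) (h₂ : 0 ≤ e₂) (ha : 0 < a)
    (hb : 0 < b) (hA : 0 ≤ A) (hB : 0 ≤ B) (hη0 : 0 ≤ η) (hη1 : η ≤ 1) (h1 : e₁ ^ a ≤ A * η)
    (h2 : e₂ ^ b ≤ B * η) : (e₁ + e₂) ^ (a * b) ≤ 2 ^ (a * b - 1) * (A ^ b + B ^ a) * η := by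
  have h3 : e₁ ^ (a * b) ≤ A ^ b * η := by
    rw [pow_mul]
    calc _ ≤ (A * η) ^ b := by gcongr
      _ = A ^ b * η ^ b := mul_pow _ _ _
      _ ≤ _ := by gcongr; exact pow_le_of_le_one hη0 hη1 hb.ne'
  have h4 : e₂ ^ (a * b) ≤ B ^ a * η := by
    rw [mul_comm, pow_mul]
    calc _ ≤ (B * η) ^ a := by gcongr
      _ = B ^ a * η ^ a := mul_pow _ _ _
      _ ≤ _ := by gcongr; exact pow_le_of_le_one hη0 hη1 ha.ne'
  calc _ ≤ 2 ^ (a * b - 1) * (e₁ ^ (a * b) + e₂ ^ (a * b)) := add_pow_le h₁ h₂ _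
    _ ≤ 2 ^ (a * b - 1) * (A ^ b * η + B ^ a * η) := by gcongr
    _ = _ := by ring

/-! ### The counting theorem over a finite field -/

section Counting

variable {F : Type u} [Field F] [Fintype F] {m n : ℕ}

/-- The counting average for polynomials over `F`, with `f₀` singled out. -/
noncomputable def polyCount (P : Fin m → F[X]) (Q : Fin n → F[X]) (f₀ : F → ℂ)
    (f : Fin m → F → ℂ) (ψ : Fin n → AddChar F ℂ) : ℂ :=
  𝔼 x, 𝔼 y, f₀ x * (∏ i, f i (x + (P i).eval y)) * ∏ j, ψ j ((Q j).eval y)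

/-- Linearly independent polynomials of degree at most `D` with zero constant term. -/
structure IsIndependentSystem (D : ℕ) (P : Fin m → F[X]) (Q : Fin n → F[X]) : Prop where
  coeff_left : ∀ i, (P i).coeff 0 = 0
  coeff_right : ∀ j, (Q j).coeff 0 = 0
  natDegree_left : ∀ i, (P i).natDegree ≤ D
  natDegree_right : ∀ j, (Q j).natDegree ≤ D
  linearIndependent : LinearIndependent F (Sum.elim P Q)

omit [Fintype F] in
lemma IsIndependentSystem.cons_right {D : ℕ} {P : Fin (m + 1) → F[X]} {Q : Fin n → F[X]}
    (h : IsIndependentSystem D P Q) :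
    IsIndependentSystem D (fun i : Fin m ↦ P i.succ) (Fin.cons (P 0) Q : Fin (n + 1) → F[X]) where
  coeff_left i := h.coeff_left _
  coeff_right j := by
    refine Fin.cases ?_ (fun j ↦ ?_) j
    · exact h.coeff_left 0
    · exact h.coeff_right j
  natDegree_left i := h.natDegree_left _
  natDegree_right j := by
    refine Fin.cases ?_ (fun j ↦ ?_) j
    · exact h.natDegree_left 0
    · exact h.natDegree_right j
  linearIndependent := by
    set τ : Fin m ⊕ Fin (n + 1) → Fin (m + 1) ⊕ Fin n :=
      Sum.elim (fun i ↦ Sum.inl i.succ) (Fin.cons (Sum.inl 0) fun j ↦ Sum.inr j) with hτ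
    have hinj : Function.Injective τ := by
      rintro (i | i) (j | j) hij
      · simpa [hτ] using hij
      · refine Fin.cases (fun hij ↦ ?_) (fun j hij ↦ ?_) j hij <;> simp [hτ] at hij
      · refine Fin.cases (fun hij ↦ ?_) (fun i hij ↦ ?_) i hij <;> simp [hτ] at hij
        exact (Fin.succ_ne_zero _ hij.symm).elim
      · revert hij
        refine Fin.cases ?_ (fun i ↦ ?_) i <;> refine Fin.cases ?_ (fun j ↦ ?_) j <;> simp [hτ]
    convert h.linearIndependent.comp τ hinj using 1
    ext1 k
    rcases k with i | j
    · rfl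
    · refine Fin.cases ?_ (fun j ↦ ?_) j <;> rfl

omit [Fintype F] in
lemma IsIndependentSystem.sub {D : ℕ} {P : Fin (m + 1) → F[X]} {Q : Fin n → F[X]}
    (h : IsIndependentSystem D P Q) :
    IsIndependentSystem D (fun i : Fin m ↦ P i.succ - P 0) Q where
  coeff_left i := by rw [coeff_sub, h.coeff_left, h.coeff_left, sub_zero]
  coeff_right := h.coeff_right
  natDegree_left i := (natDegree_sub_le _ _).trans (max_le (h.natDegree_left _) (h.natDegree_left _))
  natDegree_right := h.natDegree_right
  linearIndependent := by
    rw [Fintype.linearIndependent_iff]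
    intro c hc
    have h1 := Fintype.linearIndependent_iff.1 h.linearIndependent
      (Sum.elim (Fin.cons (-∑ i, c (Sum.inl i)) fun i ↦ c (Sum.inl i)) fun j ↦ c (Sum.inr j)) <| by
        rw [← hc]
        simp only [Fintype.sum_sum_type, Sum.elim_inl, Sum.elim_inr, Fin.sum_univ_succ,
          Fin.cons_zero, Fin.cons_succ, smul_sub, Finset.sum_sub_distrib, neg_smul,
          ← Finset.sum_smul]
        ring
    rintro (i | j)
    · simpa using h1 (Sum.inl i.succ)
    · simpa using h1 (Sum.inr j)

/-- Control of counting averages by Gowers norms. -/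
lemma exists_polyCount_pow_le (m n D : ℕ) : ∃ M K : ℕ, 0 < M ∧
    ∀ (F : Type u) [Field F] [Fintype F], D < ringChar F →
    ∀ (P : Fin (m + 1) → F[X]) (Q : Fin n → F[X]), IsIndependentSystem D P Q →
    ∀ (f₀ : F → ℂ) (f : Fin (m + 1) → F → ℂ) (ψ : Fin n → AddChar F ℂ), IsOneBounded f₀ →
      (∀ i, IsOneBounded (f i)) →
      ‖polyCount P Q f₀ f ψ‖ ^ M ≤ M * ((Fintype.card F : ℝ)⁻¹ + gowersPow K (f 0)) := by
  obtain ⟨M, K, hM, h⟩ := exists_polyAverage_pow_le.{u} D (Option (Fin (m + 1) ⊕ Fin n))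
  refine ⟨M, K, hM, fun F _ _ hF P Q hPQ f₀ f ψ hf₀ hf ↦ ?_⟩
  -- The entry `none` carries `f₀` with the zero polynomial. Since `ψ (Q y) = conj (ψ x) * ψ (x + Q
  -- y)`, characters act as ordinary functions and the conjugates join `f₀`.
  set U : Option (Fin (m + 1) ⊕ Fin n) → F[X] := fun o ↦ o.elim 0 (Sum.elim P Q) with hU
  set g : Option (Fin (m + 1) ⊕ Fin n) → F → ℂ := fun o ↦
    o.elim (fun x ↦ f₀ x * ∏ j, conj (ψ j x)) (Sum.elim f fun j ↦ ψ j) with hg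
  have hU0 : ∀ o, (U o).coeff 0 = 0 := by
    rintro (_ | i | j)
    · simp [hU]
    · exact hPQ.coeff_left i
    · exact hPQ.coeff_right j
  have hpos : ∀ V : F[X], V.coeff 0 = 0 → V ≠ 0 → 0 < V.natDegree := fun V h0 hV ↦
    Nat.pos_of_ne_zero fun hd ↦ hV (by rw [eq_C_of_natDegree_eq_zero hd, h0, C_0])
  have hne0 := hPQ.linearIndependent.ne_zero (Sum.inl 0)
  have key := h F hF U (some (Sum.inl 0)) g ?_ (hpos _ (hU0 _) hne0) ?_ ?_
  · convert key using 3
    swap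
    · rfl
    refine Finset.expect_congr rfl fun x _ ↦ Finset.expect_congr rfl fun y _ ↦ ?_
    rw [Fintype.prod_option, Fintype.prod_sum_type]
    simp only [hU, hg, Option.elim_none, Option.elim_some, Sum.elim_inl, Sum.elim_inr, eval_zero,
      add_zero]
    have h1 : ∏ j, ψ j (x + (Q j).eval y) = (∏ j, ψ j x) * ∏ j, ψ j ((Q j).eval y) := by
      rw [← Finset.prod_mul_distrib]
      exact Finset.prod_congr rfl fun j _ ↦ AddChar.map_add_eq_mul _ _ _
    have h2 : (∏ j, conj (ψ j x)) * ∏ j, ψ j x = 1 := by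
      rw [← Finset.prod_mul_distrib]
      refine Finset.prod_eq_one fun j _ ↦ ?_
      rw [Complex.conj_mul', AddChar.norm_apply]
      simp
    rw [h1]
    linear_combination (-(f₀ x * (∏ i, f i (x + (P i).eval y)) * ∏ j, ψ j ((Q j).eval y))) * h2
  · rintro (_ | i | j)
    · simp [hU]
    · exact hPQ.natDegree_left i
    · exact hPQ.natDegree_right j
  · intro o ho
    refine hpos _ (by rw [coeff_sub, hU0, hU0, sub_zero]) (sub_ne_zero.2 ?_)
    rcases o with _ | k
    · exact hne0
    · refine fun hk ↦ ho ?_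
      have hk' : Sum.elim P Q (Sum.inl 0) = Sum.elim P Q k := hk
      rw [hPQ.linearIndependent.injective hk']
  · rintro (_ | i | j)
    · refine hf₀.mul (IsOneBounded.prod fun j x ↦ ?_)
      simp
    · exact hf i
    · exact fun x ↦ by simp [hg]

/-- The error bound of the counting theorem for `m` functions besides `f₀` and `n` characters. -/
def HasCountingBound (m n D M : ℕ) (B : ℝ) : Prop :=
  ∀ (F : Type u) [Field F] [Fintype F], D < ringChar F →
    ∀ (P : Fin m → F[X]) (Q : Fin n → F[X]), IsIndependentSystem D P Q →
    ∀ (f₀ : F → ℂ) (f : Fin m → F → ℂ) (ψ : Fin n → AddChar F ℂ), IsOneBounded f₀ →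
      (∀ i, IsOneBounded (f i)) →
      ‖polyCount P Q f₀ f ψ - trivialIndicator ψ * ((𝔼 x, f₀ x) * ∏ i, 𝔼 x, f i x)‖ ^ M ≤
        B * (Fintype.card F : ℝ)⁻¹

lemma hasCountingBound_zero (n D : ℕ) : HasCountingBound.{u} 0 n D (2 ^ D) D := by
  intro F _ _ hF P Q hPQ f₀ f ψ hf₀ _
  have h1 : polyCount P Q f₀ f ψ = (𝔼 x, f₀ x) * 𝔼 y, ∏ j, ψ j ((Q j).eval y) := by
    simp only [polyCount, Finset.univ_eq_empty, Finset.prod_empty, mul_one]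
    rw [Finset.expect_mul_expect]
  rw [h1]
  by_cases hψ : ∀ j, ψ j = 1
  · simp [trivialIndicator, hψ]
    positivity
  · simp only [trivialIndicator, if_neg hψ, zero_mul, sub_zero]
    have h2 := norm_expect_prod_addChar_pow_le hF hPQ.coeff_right hPQ.natDegree_right
      (by simpa using hPQ.linearIndependent.comp Sum.inr Sum.inr_injective) hψ
    refine le_trans (pow_le_pow_left₀ (norm_nonneg _) ?_ _) h2
    rw [norm_mul]
    exact mul_le_of_le_one_left (norm_nonneg _) (norm_expect_le_of_forall_le hf₀)

/-- The derivative of a unimodular constant is `1`, so the character survives only for `k = 0`. -/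
lemma exists_mulDiffs_const_addChar {G : Type u} [AddCommGroup G] [Finite G] (k : ℕ)
    (h : Fin k → G) (ψ : AddChar G ℂ) :
    ∃ ψ' : AddChar G ℂ, ∀ c, mulDiffs k h (fun _ ↦ ψ c) = fun _ ↦ ψ' c := by
  induction k generalizing ψ with
  | zero => exact ⟨ψ, fun c ↦ rfl⟩
  | succ k ih =>
    obtain ⟨ψ', h'⟩ := ih (Fin.tail h) 1
    refine ⟨ψ', fun c ↦ ?_⟩
    rw [← h', mulDiffs]
    congr 1
    ext x
    rw [mulDiff, Complex.mul_conj', AddChar.norm_apply]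
    simp

/-- The functions whose average over `y` is dual to the counting average in the function attached
to `P 0`. -/
noncomputable def dualFun (P : Fin (m + 1) → F[X]) (Q : Fin n → F[X]) (f₀ : F → ℂ)
    (f : Fin m → F → ℂ) (ψ : Fin n → AddChar F ℂ) (y x : F) : ℂ :=
  conj (f₀ (x + -(P 0).eval y) * (∏ i, f i (x + ((P i.succ).eval y - (P 0).eval y))) *
    ∏ j, ψ j ((Q j).eval y))

omit [Fintype F] in
lemma isOneBounded_dualFun [Finite F] (P : Fin (m + 1) → F[X]) (Q : Fin n → F[X]) {f₀ : F → ℂ}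
    {f : Fin m → F → ℂ} (ψ : Fin n → AddChar F ℂ) (hf₀ : IsOneBounded f₀)
    (hf : ∀ i, IsOneBounded (f i)) (y : F) : IsOneBounded (dualFun P Q f₀ f ψ y) := by
  refine (((hf₀.comp _).mul (IsOneBounded.prod fun i ↦ (hf i).comp _)).mul
    (IsOneBounded.prod fun j x ↦ ?_)).conj
  rw [AddChar.norm_apply]

/-- Translating `x` by `P₀(y)` splits `χ`: one factor joins `f₀`, the other is a new character on
`P₀`. A function has been traded for a character. -/
lemma norm_expect_mulDiffs_dualFun (P : Fin (m + 1) → F[X]) (Q : Fin n → F[X]) (f₀ : F → ℂ)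
    (f : Fin m → F → ℂ) (ψ : Fin n → AddChar F ℂ) {k : ℕ} (h : Fin k → F) (χ : AddChar F ℂ) :
    ∃ ψ' : Fin n → AddChar F ℂ, ‖𝔼 x, 𝔼 y, mulDiffs k h (dualFun P Q f₀ f ψ y) x * χ x‖ =
      ‖polyCount (fun i : Fin m ↦ P i.succ) (Fin.cons (P 0) Q : Fin (n + 1) → F[X])
        (fun x ↦ mulDiffs k h f₀ x * χ⁻¹ x) (fun i ↦ mulDiffs k h (f i))
        (Fin.cons χ⁻¹ ψ' : Fin (n + 1) → AddChar F ℂ)‖ := by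
  choose ψ' hψ' using fun j ↦ exists_mulDiffs_const_addChar k h (ψ j)
  refine ⟨ψ', ?_⟩
  have h1 : ∀ y, mulDiffs k h (dualFun P Q f₀ f ψ y) = fun x ↦
      conj (mulDiffs k h f₀ (x + -(P 0).eval y) *
        (∏ i, mulDiffs k h (f i) (x + ((P i.succ).eval y - (P 0).eval y))) *
        ∏ j, ψ' j ((Q j).eval y)) := by
    intro y
    unfold dualFun
    rw [mulDiffs_conj, mulDiffs_mul, mulDiffs_mul, mulDiffs_prod, mulDiffs_prod]
    simp only [mulDiffs_comp_add, hψ']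
  rw [← RCLike.norm_conj]
  congr 1
  rw [expect_expect_shift fun y ↦ -(P 0).eval y, conj_expect]
  refine Finset.expect_congr rfl fun x _ ↦ ?_
  rw [conj_expect]
  refine Finset.expect_congr rfl fun y _ ↦ ?_
  have h2 : ∀ z, χ⁻¹ z = conj (χ z) := fun z ↦ by
    rw [AddChar.inv_apply, AddChar.map_neg_eq_conj]
  have h3 : ∀ b, x - -(P 0).eval y + (b - (P 0).eval y) = x + b := fun b ↦ by ring
  rw [h1, map_mul, Complex.conj_conj, Fin.prod_univ_succ]
  simp only [Fin.cons_zero, Fin.cons_succ, h2, h3]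
  rw [sub_add_cancel, sub_neg_eq_add, AddChar.map_add_eq_mul, map_mul]
  ring

lemma norm_expect_mulDiffs_dualFun_pow_le {D M : ℕ} {B : ℝ}
    (hB : HasCountingBound.{u} m (n + 1) D M B) (hF : D < ringChar F)
    {P : Fin (m + 1) → F[X]} {Q : Fin n → F[X]} (hPQ : IsIndependentSystem D P Q) {f₀ : F → ℂ}
    {f : Fin m → F → ℂ} (ψ : Fin n → AddChar F ℂ) (hf₀ : IsOneBounded f₀)
    (hf : ∀ i, IsOneBounded (f i)) {k : ℕ} (h : Fin k → F) (χ : AddChar F ℂ)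
    (hχ : χ ≠ 1 ∨ 𝔼 x, mulDiffs k h f₀ x = 0) :
    ‖𝔼 x, 𝔼 y, mulDiffs k h (dualFun P Q f₀ f ψ y) x * χ x‖ ^ M ≤
      B * (Fintype.card F : ℝ)⁻¹ := by
  obtain ⟨ψ', h1⟩ := norm_expect_mulDiffs_dualFun P Q f₀ f ψ h χ
  have h2 := hB F hF _ _ hPQ.cons_right (fun x ↦ mulDiffs k h f₀ x * χ⁻¹ x)
    (fun i ↦ mulDiffs k h (f i)) (Fin.cons χ⁻¹ ψ' : Fin (n + 1) → AddChar F ℂ)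
    ((hf₀.mulDiffs h).mul fun x ↦ by rw [AddChar.norm_apply]) fun i ↦ (hf i).mulDiffs h
  have h3 : trivialIndicator (Fin.cons χ⁻¹ ψ' : Fin (n + 1) → AddChar F ℂ) *
      ((𝔼 x, mulDiffs k h f₀ x * χ⁻¹ x) * ∏ i, 𝔼 x, mulDiffs k h (f i) x) = 0 := by
    by_cases hχ1 : χ = 1
    · have h4 := hχ.resolve_left (not_not.2 hχ1)
      simp [hχ1, h4]
    · have : ¬ ∀ j, (Fin.cons χ⁻¹ ψ' : Fin (n + 1) → AddChar F ℂ) j = 1 := fun h0 ↦ hχ1 <| by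
        simpa using h0 0
      rw [trivialIndicator, if_neg this, zero_mul]
  rw [h3, sub_zero] at h2
  rwa [h1]

/-- The average pairs `f 0` with the dual function `G`. Cauchy–Schwarz leaves the mean of `‖G‖ ^ 2`,
which is the same average with `G` for `f 0`. -/
lemma norm_polyCount_sq_le (P : Fin (m + 1) → F[X]) (Q : Fin n → F[X]) (f₀ : F → ℂ)
    {f : Fin (m + 1) → F → ℂ} (ψ : Fin n → AddChar F ℂ) (hf : IsOneBounded (f 0)) :
    ‖polyCount P Q f₀ f ψ‖ ^ 2 ≤ ‖polyCount P Q f₀ (Fin.cons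
      (fun x ↦ 𝔼 y, dualFun P Q f₀ (fun i ↦ f i.succ) ψ y x) fun i ↦ f i.succ) ψ‖ := by
  set G : F → ℂ := fun x ↦ 𝔼 y, dualFun P Q f₀ (fun i ↦ f i.succ) ψ y x with hG
  have h1 : ∀ g : F → ℂ, polyCount P Q f₀ (Fin.cons g fun i ↦ f i.succ) ψ =
      𝔼 x, g x * conj (G x) := by
    intro g
    rw [polyCount, expect_expect_shift fun y ↦ (P 0).eval y]
    refine Finset.expect_congr rfl fun x _ ↦ ?_
    rw [hG, conj_expect, Finset.mul_expect]
    refine Finset.expect_congr rfl fun y _ ↦ ?_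
    rw [dualFun, Complex.conj_conj, Fin.prod_univ_succ]
    simp only [Fin.cons_zero, Fin.cons_succ, sub_add_cancel, ← sub_eq_add_neg]
    simp only [sub_add_eq_add_sub, ← add_sub_assoc]
    ring
  have h2 := h1 (f 0)
  rw [show (Fin.cons (f 0) fun i ↦ f i.succ : Fin (m + 1) → F → ℂ) = f from
    Fin.cons_self_tail f] at h2
  have h3 : ((𝔼 x, ‖G x‖ ^ 2 : ℝ) : ℂ) = 𝔼 x, G x * conj (G x) := by
    rw [ofReal_expect]
    refine Finset.expect_congr rfl fun x _ ↦ ?_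
    rw [Complex.mul_conj']
    push_cast
    rfl
  rw [h1, h2, ← h3, Complex.norm_real]
  refine le_trans (norm_expect_mul_sq_le hf) ?_
  simp only [RCLike.norm_conj]
  exact le_abs_self _

/-- Counting averages with `f₀` of mean zero are small. -/
lemma exists_polyCount_pow_le_of_expect_eq_zero {D M : ℕ} {B : ℝ}
    (hMB : HasCountingBound.{u} m (n + 1) D M B) (hM : 0 < M) (hB : 0 ≤ B) :
    ∃ (M' : ℕ) (B' : ℝ), 0 < M' ∧ 0 ≤ B' ∧
    ∀ (F : Type u) [Field F] [Fintype F], D < ringChar F →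
    ∀ (P : Fin (m + 1) → F[X]) (Q : Fin n → F[X]), IsIndependentSystem D P Q →
    ∀ (f₀ : F → ℂ) (f : Fin (m + 1) → F → ℂ) (ψ : Fin n → AddChar F ℂ), IsOneBounded f₀ →
      (∀ i, IsOneBounded (f i)) → 𝔼 x, f₀ x = 0 →
      ‖polyCount P Q f₀ f ψ‖ ^ M' ≤ B' * (Fintype.card F : ℝ)⁻¹ := by
  obtain ⟨M₁, K, hM₁, h₁⟩ := exists_polyCount_pow_le.{u} m n D
  obtain ⟨M₂, A, hM₂, hA, h₂⟩ := exists_gowersPow_pow_le.{u} K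
  refine ⟨2 * M₁ * (1 * (M₂ * M)),
    M₁ ^ (1 * (M₂ * M)) * (2 ^ (1 * (M₂ * M) - 1) * (1 ^ (M₂ * M) + (A ^ M * B) ^ 1)),
    by positivity, by positivity, fun F _ _ hF P Q hPQ f₀ f ψ hf₀ hf h0 ↦ ?_⟩
  set η := (Fintype.card F : ℝ)⁻¹ with hη
  have hη0 : 0 ≤ η := by positivity
  have hη1 : η ≤ 1 := inv_card_le_one F
  -- The inductive bound after an `M`-th root, capped because degree lowering needs `ε ≤ 1`; the
  -- averages it bounds never exceed `1`.
  set ε : ℝ := min 1 (B * η) ^ (M : ℝ)⁻¹ with hε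
  have hmin : 0 ≤ min 1 (B * η) := le_min zero_le_one (by positivity)
  have hε0 : 0 ≤ ε := by positivity
  have hε1 : ε ≤ 1 := Real.rpow_le_one hmin (min_le_left _ _) (by positivity)
  have hεM : ε ^ M ≤ B * η := by
    rw [hε, Real.rpow_inv_natCast_pow hmin hM.ne']
    exact min_le_right _ _
  have hle : ∀ X : ℝ, 0 ≤ X → X ≤ 1 → X ^ M ≤ B * η → X ≤ ε := fun X hX0 hX1 hX ↦ by
    rw [← Real.pow_rpow_inv_natCast hX0 hM.ne']
    exact Real.rpow_le_rpow (by positivity) (le_min (pow_le_one₀ hX0 hX1) hX) (by positivity)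
  set Φ : F → F → ℂ := dualFun P Q f₀ (fun i ↦ f i.succ) ψ with hΦ
  have hΦ1 : ∀ y, IsOneBounded (Φ y) := isOneBounded_dualFun P Q ψ hf₀ fun i ↦ hf _
  have hdual : ∀ (k : ℕ) (h : Fin k → F) (χ : AddChar F ℂ),
      (χ ≠ 1 ∨ 𝔼 x, mulDiffs k h f₀ x = 0) → ‖𝔼 x, 𝔼 y, mulDiffs k h (Φ y) x * χ x‖ ≤ ε := by
    intro k h χ hχ
    refine hle _ (norm_nonneg _) ?_ (norm_expect_mulDiffs_dualFun_pow_le hMB hF hPQ ψ hf₀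
      (fun i ↦ hf _) h χ hχ)
    refine norm_expect_le_of_forall_le fun x ↦ norm_expect_le_of_forall_le fun y ↦ ?_
    rw [norm_mul, AddChar.norm_apply, mul_one]
    exact (hΦ1 y).mulDiffs h x
  -- The mean of the dual function is the case `k = 0`, `χ = 1`; here the vanishing mean of `f₀`
  -- enters.
  have h3 := h₂ hΦ1 hε0 hε1 (fun k h χ hχ ↦ hdual k h χ (Or.inl hχ))
    (by simpa [mulDiffs] using hdual 0 Fin.elim0 1 (Or.inr (by simpa [mulDiffs] using h0)))
  set G : F → ℂ := fun x ↦ 𝔼 y, Φ y x with hG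
  have hG1 : IsOneBounded G := IsOneBounded.expect hΦ1
  have h4 := h₁ F hF P Q hPQ f₀ (Fin.cons G fun i ↦ f i.succ) ψ hf₀ fun i ↦ by
    refine Fin.cases ?_ (fun i ↦ ?_) i
    · exact hG1
    · exact hf _
  rw [Fin.cons_zero] at h4
  have h5 := norm_polyCount_sq_le P Q f₀ ψ (hf 0)
  rw [← hΦ, ← hG] at h5
  have h6 := gowersPow_nonneg K G
  have h7 : gowersPow K G ^ (M₂ * M) ≤ A ^ M * B * η := by
    rw [pow_mul]
    calc _ ≤ (A * ε) ^ M := by gcongr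
      _ = A ^ M * ε ^ M := mul_pow _ _ _
      _ ≤ A ^ M * (B * η) := by gcongr
      _ = _ := by ring
  have h8 := add_pow_mul_le hη0 h6 one_pos (Nat.mul_pos hM₂ hM) zero_le_one
    (by positivity : 0 ≤ A ^ M * B) hη0 hη1 (by simp) h7
  have h9 : ‖polyCount P Q f₀ f ψ‖ ^ (2 * M₁) ≤ M₁ * (η + gowersPow K G) := by
    rw [pow_mul]
    exact (pow_le_pow_left₀ (by positivity) h5 _).trans h4
  rw [pow_mul _ (2 * M₁)]
  calc _ ≤ (M₁ * (η + gowersPow K G)) ^ (1 * (M₂ * M)) := by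
        gcongr
    _ = M₁ ^ (1 * (M₂ * M)) * (η + gowersPow K G) ^ (1 * (M₂ * M)) := mul_pow _ _ _
    _ ≤ M₁ ^ (1 * (M₂ * M)) *
        (2 ^ (1 * (M₂ * M) - 1) * (1 ^ (M₂ * M) + (A ^ M * B) ^ 1) * η) := by gcongr
    _ = _ := by ring

lemma polyCount_add (P : Fin m → F[X]) (Q : Fin n → F[X]) (c d : ℂ) (a b : F → ℂ)
    (f : Fin m → F → ℂ) (ψ : Fin n → AddChar F ℂ) :
    polyCount P Q (fun x ↦ c * a x + d * b x) f ψ =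
      c * polyCount P Q a f ψ + d * polyCount P Q b f ψ := by
  simp only [polyCount, Finset.mul_expect, ← Finset.expect_add_distrib]
  refine Finset.expect_congr rfl fun x _ ↦ Finset.expect_congr rfl fun y _ ↦ ?_
  ring

lemma polyCount_one (P : Fin (m + 1) → F[X]) (Q : Fin n → F[X]) (f : Fin (m + 1) → F → ℂ)
    (ψ : Fin n → AddChar F ℂ) : polyCount P Q (fun _ ↦ 1) f ψ =
      polyCount (fun i : Fin m ↦ P i.succ - P 0) Q (f 0) (fun i ↦ f i.succ) ψ := by
  rw [polyCount, expect_expect_shift fun y ↦ (P 0).eval y]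
  refine Finset.expect_congr rfl fun x _ ↦ Finset.expect_congr rfl fun y _ ↦ ?_
  rw [Fin.prod_univ_succ, sub_add_cancel, one_mul]
  simp only [eval_sub, sub_add_eq_add_sub, add_sub_assoc]

/-- The counting theorem for linearly independent polynomials over a finite field. -/
theorem exists_hasCountingBound (m n D : ℕ) :
    ∃ (M : ℕ) (B : ℝ), 0 < M ∧ 0 ≤ B ∧ HasCountingBound.{u} m n D M B := by
  induction m generalizing n with
  | zero => exact ⟨2 ^ D, D, by positivity, by positivity, hasCountingBound_zero n D⟩
  | succ m ih =>
    obtain ⟨M₁, B₁, hM₁, hB₁, h₁⟩ := ih n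
    obtain ⟨M₂, B₂, hM₂, hB₂, h₂⟩ := ih (n + 1)
    obtain ⟨M₃, B₃, hM₃, hB₃, h₃⟩ := exists_polyCount_pow_le_of_expect_eq_zero h₂ hM₂ hB₂
    refine ⟨M₁ * M₃, 2 ^ (M₁ * M₃ - 1) * (B₁ ^ M₃ + (2 ^ M₃ * B₃) ^ M₁), by positivity,
      by positivity, fun F _ _ hF P Q hPQ f₀ f ψ hf₀ hf ↦ ?_⟩
    set a := 𝔼 x, f₀ x with ha
    have ha1 : ‖a‖ ≤ 1 := norm_expect_le_of_forall_le hf₀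
    -- Halving keeps the mean zero part `1`-bounded; the lost factor returns as `2 ^ M₃`.
    set b : F → ℂ := fun x ↦ (f₀ x - a) / 2 with hb
    have hb1 : IsOneBounded b := fun x ↦ by
      rw [hb, norm_div, div_le_one (by simp)]
      calc ‖f₀ x - a‖ ≤ ‖f₀ x‖ + ‖a‖ := norm_sub_le _ _
        _ ≤ ‖(2 : ℂ)‖ := by
          have := hf₀ x
          norm_num
          linarith
    have hb0 : 𝔼 x, b x = 0 := by
      rw [hb, ← Finset.expect_div, Finset.expect_sub_distrib, Fintype.expect_const, ← ha, sub_self,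
        zero_div]
    have h4 : polyCount P Q f₀ f ψ = a * polyCount P Q (fun _ ↦ 1) f ψ +
        2 * polyCount P Q b f ψ := by
      rw [← polyCount_add]
      congr 1
      ext x
      simp only [hb]
      ring
    have h5 := h₁ F hF _ Q hPQ.sub (f 0) (fun i ↦ f i.succ) ψ (hf 0) fun i ↦ hf _
    have h6 := h₃ F hF P Q hPQ b f ψ hb1 hf hb0
    rw [← polyCount_one, ← Fin.prod_univ_succ (fun i ↦ 𝔼 x, f i x)] at h5
    have h7 : (2 * ‖polyCount P Q b f ψ‖) ^ M₃ ≤ 2 ^ M₃ * B₃ * (Fintype.card F : ℝ)⁻¹ := by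
      rw [mul_pow, mul_assoc]
      gcongr
    refine le_trans (pow_le_pow_left₀ (norm_nonneg _) ?_ _)
      (add_pow_mul_le (norm_nonneg _) (by positivity) hM₁ hM₃ hB₁ (by positivity) (by positivity)
        (inv_card_le_one F) h5 h7)
    rw [h4]
    calc _ = ‖a * (polyCount P Q (fun _ ↦ 1) f ψ - trivialIndicator ψ * ∏ i, 𝔼 x, f i x) +
          2 * polyCount P Q b f ψ‖ := by congr 1; ring
      _ ≤ ‖a‖ * ‖polyCount P Q (fun _ ↦ 1) f ψ - trivialIndicator ψ * ∏ i, 𝔼 x, f i x‖ +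
          2 * ‖polyCount P Q b f ψ‖ := by
        refine (norm_add_le _ _).trans (le_of_eq ?_)
        rw [norm_mul, norm_mul]
        norm_num
      _ ≤ _ := by
        gcongr
        exact mul_le_of_le_one_left (norm_nonneg _) ha1

end Counting

/-! ### Passing from the rationals to large characteristic -/

/-- Clearing denominators in a rational left inverse gives an integral certificate of independence,
valid in any field where `N` is nonzero. -/
lemma exists_int_leftInverse {κ : Type*} [Fintype κ] [DecidableEq κ] {v : κ → ℤ[X]}
    (hv : LinearIndependent ℚ fun k ↦ (v k).map (Int.castRingHom ℚ)) {D : ℕ}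
    (hD : ∀ k, (v k).natDegree ≤ D) : ∃ (N : ℤ) (b : ℕ → κ → ℤ), N ≠ 0 ∧
      ∀ k l, ∑ i ∈ range (D + 1), (v k).coeff i * b i l = if k = l then N else 0 := by
  classical
  obtain ⟨g, hg⟩ := (Fintype.linearCombination ℚ
    fun k ↦ (v k).map (Int.castRingHom ℚ)).exists_leftInverse_of_injective
    (LinearMap.ker_eq_bot.2 hv.fintypeLinearCombination_injective)
  obtain ⟨N, hN⟩ := IsLocalization.exist_integer_multiples_of_finset (nonZeroDivisors ℤ)
    ((range (D + 1) ×ˢ (univ : Finset κ)).image fun p ↦ g (X ^ p.1) p.2)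
  have hb : ∀ i l, ∃ b : ℤ, i ∈ range (D + 1) → (b : ℚ) = (N : ℤ) * g (X ^ i) l := by
    intro i l
    by_cases hi : i ∈ range (D + 1)
    · obtain ⟨b, hb⟩ := hN _ (mem_image.2 ⟨(i, l), mem_product.2 ⟨hi, mem_univ l⟩, rfl⟩)
      exact ⟨b, fun _ ↦ by simpa [Algebra.smul_def] using hb⟩
    · exact ⟨0, fun h ↦ (hi h).elim⟩
  choose b hb using hb
  refine ⟨N, b, nonZeroDivisors.ne_zero N.2, fun k l ↦ ?_⟩
  have h1 : g ((v k).map (Int.castRingHom ℚ)) l = if k = l then 1 else 0 := by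
    have h2 := congrFun (LinearMap.congr_fun hg (Pi.single k 1)) l
    simpa [Fintype.linearCombination_apply_single, Pi.single_apply, eq_comm] using h2
  have h3 : (v k).map (Int.castRingHom ℚ) =
      ∑ i ∈ range (D + 1), ((v k).coeff i : ℚ) • (X : ℚ[X]) ^ i := by
    conv_lhs => rw [as_sum_range_C_mul_X_pow' ((v k).map (Int.castRingHom ℚ))
      (Nat.lt_succ_of_le (natDegree_map_le.trans (hD k)))]
    simp [smul_eq_C_mul]
  rw [h3, map_sum, Finset.sum_apply] at h1
  have h4 : ((∑ i ∈ range (D + 1), (v k).coeff i * b i l : ℤ) : ℚ) =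
      (N : ℤ) * if k = l then (1 : ℚ) else 0 := by
    rw [← h1, Finset.mul_sum]
    push_cast
    refine Finset.sum_congr rfl fun i hi ↦ ?_
    rw [hb i l hi, map_smul, Pi.smul_apply, smul_eq_mul]
    ring
  split_ifs at h4 ⊢ <;> simp at h4 <;> exact_mod_cast h4

/-- Linear independence over `ℚ` of integer polynomials persists in large characteristic. -/
lemma exists_linearIndependent_map {κ : Type*} [Fintype κ] {v : κ → ℤ[X]}
    (hv : LinearIndependent ℚ fun k ↦ (v k).map (Int.castRingHom ℚ)) :
    ∃ c : ℕ, ∀ (F : Type u) [Field F], c < ringChar F →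
      LinearIndependent F fun k ↦ (v k).map (Int.castRingHom F) := by
  classical
  obtain ⟨N, b, hN, h⟩ := exists_int_leftInverse hv
    (D := univ.sup fun k ↦ (v k).natDegree) fun k ↦ le_sup (f := fun k ↦ (v k).natDegree) (mem_univ k)
  set D := univ.sup fun k ↦ (v k).natDegree
  refine ⟨N.natAbs, fun F _ hF ↦ Fintype.linearIndependent_iff.2 fun a ha l ↦ ?_⟩
  have hNF : (N : F) ≠ 0 := fun h0 ↦ by
    have h1 : (N.natAbs : F) = 0 := by
      rcases Int.natAbs_eq N with h2 | h2 <;> rw [h2] at h0 <;> simpa using h0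
    exact natCast_ne_zero_of_lt_ringChar (Int.natAbs_ne_zero.2 hN) hF h1
  have h1 : ∀ i, ∑ k, a k * ((v k).coeff i : F) = 0 := fun i ↦ by
    have := congrArg (fun p ↦ coeff p i) ha
    simpa [finsetSum_coeff] using this
  have h2 : ∑ i ∈ range (D + 1), (∑ k, a k * ((v k).coeff i : F)) * (b i l : F) = a l * N := by
    simp only [Finset.sum_mul]
    rw [Finset.sum_comm]
    have h3 : ∀ k, ∑ i ∈ range (D + 1), a k * ((v k).coeff i : F) * (b i l : F) =
        a k * if k = l then (N : F) else 0 := fun k ↦ by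
      have h4 := congrArg (Int.cast : ℤ → F) (h k l)
      push_cast at h4
      rw [← h4, Finset.mul_sum]
      exact Finset.sum_congr rfl fun i _ ↦ by ring
    simp [h3]
  simp only [h1, zero_mul, Finset.sum_const_zero] at h2
  exact (mul_eq_zero.1 h2.symm).resolve_right hNF

theorem theorem2 (m₁ m₂ : ℕ) (hm₁ : 1 ≤ m₁)
    (P : Fin m₁ → ℤ[X]) (Q : Fin m₂ → ℤ[X])
    (hP : ∀ i, (P i).coeff 0 = 0) (hQ : ∀ j, (Q j).coeff 0 = 0)
    (hPQ : LinearIndependent ℚ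
      (fun k : Fin m₁ ⊕ Fin m₂ => (Sum.elim P Q k).map (Int.castRingHom ℚ))) :
    ∃ (c : ℕ) (γ C : ℝ), 0 < c ∧ 0 < γ ∧ 0 < C ∧
      ∀ (F : Type*) [Field F] [Fintype F], c ≤ ringChar F →
        ∀ (f : Fin (m₁ + 1) → F → ℂ) (ψ : Fin m₂ → AddChar F ℂ),
          (∀ i, IsOneBounded (f i)) →
            ‖countingAverage P Q f (fun j => ⇑(ψ j)) -
                trivialIndicator ψ * ∏ i, 𝔼 x : F, f i x‖ ≤
              C * (Fintype.card F : ℝ) ^ (-γ) := by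
  obtain ⟨c, hc⟩ := exists_linearIndependent_map hPQ
  set D := univ.sup fun k : Fin m₁ ⊕ Fin m₂ ↦ (Sum.elim P Q k).natDegree
  have hD : ∀ k, (Sum.elim P Q k).natDegree ≤ D := fun k ↦
    le_sup (f := fun k ↦ (Sum.elim P Q k).natDegree) (mem_univ k)
  obtain ⟨M, B, hM, hB, h⟩ := exists_hasCountingBound m₁ m₂ D
  -- Characteristic above `c` preserves independence, and above `D` it permits differencing. The `+
  -- 1` in the constant ensures positivity when `B = 0`.
  refine ⟨c + D + 1, (M : ℝ)⁻¹, B ^ (M : ℝ)⁻¹ + 1, Nat.succ_pos _, by positivity, by positivity,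
    fun F _ _ hF f ψ hf ↦ ?_⟩
  have hsys : IsIndependentSystem D (fun i ↦ (P i).map (Int.castRingHom F))
      (fun j ↦ (Q j).map (Int.castRingHom F)) :=
    { coeff_left := fun i ↦ by simp [hP]
      coeff_right := fun j ↦ by simp [hQ]
      natDegree_left := fun i ↦ natDegree_map_le.trans (hD (Sum.inl i))
      natDegree_right := fun j ↦ natDegree_map_le.trans (hD (Sum.inr j))
      linearIndependent := by
        convert hc F (by omega) using 1
        ext1 k
        rcases k with i | j <;> rfl }
  have h1 := h F (by omega) _ _ hsys (f 0) (fun i ↦ f i.succ) ψ (hf 0) fun i ↦ hf _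
  have h2 : countingAverage P Q f (fun j ↦ ⇑(ψ j)) = polyCount (fun i ↦ (P i).map
      (Int.castRingHom F)) (fun j ↦ (Q j).map (Int.castRingHom F)) (f 0) (fun i ↦ f i.succ) ψ := by
    simp only [countingAverage, polyCount, aeval_def, eval₂_eq_eval_map, algebraMap_int_eq]
  rw [← h2, ← Fin.prod_univ_succ (fun i ↦ 𝔼 x, f i x)] at h1
  have h3 : (0 : ℝ) ≤ (Fintype.card F : ℝ) ^ (-(M : ℝ)⁻¹) := by positivity
  calc _ ≤ (B * (Fintype.card F : ℝ)⁻¹) ^ (M : ℝ)⁻¹ := by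
        rw [← Real.pow_rpow_inv_natCast (norm_nonneg _) hM.ne']
        exact Real.rpow_le_rpow (by positivity) h1 (by positivity)
    _ = B ^ (M : ℝ)⁻¹ * (Fintype.card F : ℝ) ^ (-(M : ℝ)⁻¹) := by
        rw [Real.mul_rpow hB (by positivity), Real.inv_rpow (by positivity),
          Real.rpow_neg (by positivity)]
    _ ≤ _ := by
        rw [add_mul]
        linarith
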